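/- Let $a:\mathbb{R}\to\mathbb{R}$ be a differentiable function with $a\in L^1(\mathbb{R})\cap L^2(\mathbb{R})$, $\int_{\mathbb{R}}a(x)\,\mathrm{d}x=1$, $a(x)=a(-x)$ for almost all $x$, $a(x)\ge a(\tilde x)\ge 0$ for almost all $0<x<\tilde x$, and $a'(x)<0$ for all $x>0$. For $0<\xi<\infty$ let $\chi_\xi$ be the indicator function of $I_\xi:=[-\xi,\xi]$ and put $$\mathcal{A}_\xi v:=\chi_\xi\cdot\bigl(a*(\chi_\xi\cdot v)\bigr),$$ considered in the space $L^2_{\mathrm{odd}}(\mathbb{R})$ of all real-valued, odd, square-integrable functions. Let $\widetilde{\mathcal{N}}_\xi$ be the set of all $v\in L^2_{\mathrm{odd}}(\mathbb{R})$ with $v(x)\le 0$ for almost all $x>0$ that have a representative which is $C^1$ on $I_\xi$ and satisfies $v'(0)<0$, $v(x)<0$ for $0<x\le\xi$, and $v(x)=0$ for $x>\xi$. For every $0<\xi<\infty$, the operator $\mathcal{A}_\xi$ has a largest eigenvalue $\lambda_\xi$ in $L^2_{\mathrm{odd}}(\mathbb{R})$, this eigenvalue is simple, and its eigenspace is spanned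 by a unique eigenfunction $v_\xi\in\widetilde{\mathcal{N}}_\xi$ with $\|v_\xi\|_2=1$. Moreover, the map $(0,\infty)\ni\xi\mapsto\lambda_\xi$ is continuous and strictly increasing with $$\lim_{\xi\searrow 0}\lambda_\xi=0,\qquad \lim_{\xi\nearrow\infty}\lambda_\xi=1,$$ and the map $(0,\infty)\ni\xi\mapsto v_\xi\in L^2(\mathbb{R})$ is continuous with respect to the $L^2$-norm. -/

import Mathlib

open MeasureTheory Filter Topology

noncomputable section

namespace KreinRutman

/-- The real Hilbert space `L²(ℝ)`. -/
abbrev L2 : Type := Lp ℝ 2 (volume : Measure ℝ)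

/-- The cone `𝒰` of even, nonnegative, unimodal `L²`-functions:
`u x = u (-x)` and `u x ≥ u x' ≥ 0` for almost all `0 < x < x'`. -/
def MemU (u : ℝ → ℝ) : Prop :=
  MemLp u 2 volume ∧ (∀ᵐ x : ℝ, u x = u (-x)) ∧
    ∀ᵐ p : ℝ × ℝ, 0 < p.1 → p.1 < p.2 → u p.2 ≤ u p.1 ∧ 0 ≤ u p.2

/-- The standing assumption on the convolution kernel. -/
structure IsKernel (a : ℝ → ℝ) : Prop where
  memU : MemU a
  integrable : Integrable a
  integral_eq_one : ∫ x, a x = 1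
  differentiable : Differentiable ℝ a
  deriv_neg : ∀ x : ℝ, 0 < x → deriv a x < 0

/-- Square-integrable odd functions. -/
def L2odd : Set L2 := {v | ∀ᵐ x : ℝ, v x = -v (-x)}

/-- The cone `𝒩`: odd `L²`-functions that are nonpositive on `(0, ∞)`. -/
def coneN : Set L2 :=
  {v | (∀ᵐ x : ℝ, v x = -v (-x)) ∧ ∀ᵐ x : ℝ, 0 < x → v x ≤ 0}

/-- The smaller cone of those `v ∈ 𝒩` which are `C¹` on `[-ξ, ξ]` with `v' 0 < 0`, `v x < 0` for
`0 < x ≤ ξ`, and `v x = 0` for `x > ξ`. An `L²`-class has these pointwise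
properties if it has a representative `g` with them. -/
def coneNtilde (ξ : ℝ) : Set L2 :=
  {v | v ∈ coneN ∧ ∃ g : ℝ → ℝ, (v : ℝ → ℝ) =ᵐ[volume] g ∧
    ContDiffOn ℝ 1 g (Set.Icc (-ξ) ξ) ∧ deriv g 0 < 0 ∧
    (∀ x, 0 < x → x ≤ ξ → g x < 0) ∧ ∀ x, ξ < x → g x = 0}

/-- The cut-off `χ_ξ · v`, where `χ_ξ` is the indicator function of `[-ξ, ξ]`. -/
def cutoff (ξ : ℝ) (v : ℝ → ℝ) : ℝ → ℝ := (Set.Icc (-ξ) ξ).indicator v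

/-- The modified convolution operator `𝒜_ξ v = χ_ξ · (a ∗ (χ_ξ · v))`. -/
def opA (a : ℝ → ℝ) (ξ : ℝ) (v : ℝ → ℝ) : ℝ → ℝ :=
  cutoff ξ (convolution a (cutoff ξ v) (ContinuousLinearMap.mul ℝ ℝ) volume)

/-- `v` is an eigenfunction of `𝒜_ξ` in `L²_odd(ℝ)` to the eigenvalue `μ`. -/
def IsEigenfunction (a : ℝ → ℝ) (ξ μ : ℝ) (v : L2) : Prop :=
  v ∈ L2odd ∧ v ≠ 0 ∧ ∀ᵐ x : ℝ, opA a ξ v x = μ * v x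

/-- The set of eigenvalues of `𝒜_ξ` in `L²_odd(ℝ)`. -/
def eigenvalues (a : ℝ → ℝ) (ξ : ℝ) : Set ℝ := {μ | ∃ v : L2, IsEigenfunction a ξ μ v}

/-- `λ_ξ`, the largest eigenvalue of `𝒜_ξ` in `L²_odd(ℝ)`. -/
def krEigenvalue (a : ℝ → ℝ) (ξ : ℝ) : ℝ := sSup (eigenvalues a ξ)

/-- `v` is an `L²`-normalized eigenfunction to `λ_ξ` in the smaller cone. -/
def IsKREigenfunction (a : ℝ → ℝ) (ξ : ℝ) (v : L2) : Prop :=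
  IsEigenfunction a ξ (krEigenvalue a ξ) v ∧ v ∈ coneNtilde ξ ∧ ‖v‖ = 1

/-- `v_ξ`, the normalized eigenfunction to `λ_ξ` in the smaller cone. -/
def krEigenfunction (a : ℝ → ℝ) (ξ : ℝ) : L2 := Classical.epsilon (IsKREigenfunction a ξ)

end KreinRutman

end

namespace KreinRutman

open Set
open scoped RealInnerProductSpace

/-! ### Convergence in `L²` -/

/-! On odd functions, convolution with `a` has the kernel `(a (x - y) - a (x + y)) / 2`. Conjugation
with the sign function `negSign` turns this into `foldKernel a`, which is symmetric, bounded,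
continuous and, because `a` is even and strictly decreasing in `|x|`, strictly positive off the
axes. It also turns the cone `coneN` into nonnegative functions. Through this dictionary
(`isEigenfunction_iff`) the theorem becomes Perron–Frobenius theory for the operators `op ξ` of a
positive kernel.

These operators are symmetric and compact, even jointly in `ξ` (`tendsto_op`), so the largest
eigenvalue is the operator norm and has a nonnegative eigenfunction (`exists_nonneg_eigen`). Strict
positivity makes this eigenvalue simple (`eigen_eq_smul_perron`), and no other positive eigenvalue
has a nonnegative eigenfunction (`eigenvalue_eq_of_nonneg`). Continuity in `ξ` then follows from
compactness and uniqueness.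

Strict monotonicity comes from testing the larger operator with the eigenfunction of the smaller one
(`norm_op_lt`). Both limits come from row integrals of the kernel: their maximum bounds the norm
from above (`norm_op_le`), their mean bounds it from below (`integral_integral_le`). Regularity is
read off from the eigenvalue equation, in which convolution with `a` gains one derivative
(`hasDerivAt_integral_sub_mul`). -/

/-- Dominated convergence in `L²`. -/
theorem tendsto_L2_of_dominated {f : ℕ → L2} {g : L2} (b : ℝ → ℝ) (hb : MemLp b 2)
    (hfb : ∀ n, ∀ᵐ x, |f n x| ≤ b x) (hlim : ∀ᵐ x, Tendsto (fun n => f n x) atTop (𝓝 (g x))) :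
    Tendsto f atTop (𝓝 g) := by
  rw [tendsto_iff_norm_sub_tendsto_zero]
  have hsq : ∀ n, ‖f n - g‖ ^ 2 = ∫ x, (f n x - g x) ^ 2 := by
    intro n
    rw [← real_inner_self_eq_norm_sq, L2.inner_def]
    refine integral_congr_ae ?_
    filter_upwards [Lp.coeFn_sub (f n) g] with x hx
    rw [hx]; simp [sq]
  have hgb : ∀ᵐ x, |g x| ≤ b x := by
    filter_upwards [hlim, ae_all_iff.2 hfb] with x h1 h2
    exact le_of_tendsto' h1.abs h2
  have h0 : Tendsto (fun n => ∫ x, (f n x - g x) ^ 2) atTop (𝓝 (∫ _ : ℝ, (0 : ℝ))) := by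
    refine tendsto_integral_of_dominated_convergence (fun x => (2 * b x) ^ 2) ?_ ?_ ?_ ?_
    · intro n
      exact (((Lp.aestronglyMeasurable (f n)).sub (Lp.aestronglyMeasurable g)).pow 2)
    · exact (hb.const_mul 2).integrable_sq
    · intro n
      filter_upwards [hfb n, hgb] with x h1 h2
      rw [Real.norm_eq_abs, abs_pow]
      have := abs_sub (f n x) (g x)
      gcongr
      linarith
    · filter_upwards [hlim] with x h1
      simpa using (h1.sub_const (g x)).pow 2
  simp only [integral_zero, ← hsq] at h0
  have := h0.sqrt
  simpa [Real.sqrt_sq] using this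

/-- Bounded sequences in a separable Hilbert space have weakly convergent subsequences. -/
theorem exists_subseq_tendsto_inner {H : Type*} [NormedAddCommGroup H] [InnerProductSpace ℝ H]
    [CompleteSpace H] [TopologicalSpace.SeparableSpace H] {u : ℕ → H} {C : ℝ}
    (hu : ∀ n, ‖u n‖ ≤ C) :
    ∃ w : H, ∃ φ : ℕ → ℕ, StrictMono φ ∧
      ∀ z, Tendsto (fun n => ⟪u (φ n), z⟫) atTop (𝓝 ⟪w, z⟫) := by
  -- Sequential Banach–Alaoglu in the dual, transported to `H` by the Riesz isometry.
  have hc := WeakDual.isSeqCompact_closedBall ℝ H 0 C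
  obtain ⟨a, -, φ, hφ, ha⟩ := hc
    (x := fun n => StrongDual.toWeakDual (InnerProductSpace.toDual ℝ H (u n)))
    (fun n => by simpa using hu n)
  refine ⟨(InnerProductSpace.toDual ℝ H).symm (WeakDual.toStrongDual a), φ, hφ, fun z => ?_⟩
  have h1 := ((WeakBilin.eval_continuous (topDualPairing ℝ H) z).tendsto a).comp ha
  rw [InnerProductSpace.toDual_symm_apply]
  exact h1

/-- Replacing `k n` by `k₀` costs at most `‖k n - k₀‖ * C` by Cauchy–Schwarz; what is left is weak
convergence tested with `k₀`. -/
theorem tendsto_inner_of_tendsto_of_weak {H : Type*} [NormedAddCommGroup H]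
    [InnerProductSpace ℝ H] {k : ℕ → H} {k₀ : H} {u : ℕ → H} {w : H} {C : ℝ}
    (hk : Tendsto k atTop (𝓝 k₀)) (hu : ∀ n, ‖u n‖ ≤ C)
    (hw : ∀ z, Tendsto (fun n => ⟪u n, z⟫) atTop (𝓝 ⟪w, z⟫)) :
    Tendsto (fun n => ⟪k n, u n⟫) atTop (𝓝 ⟪k₀, w⟫) := by
  have h1 : Tendsto (fun n => ⟪k n - k₀, u n⟫) atTop (𝓝 0) := by
    have h2 : Tendsto (fun n => ‖k n - k₀‖ * C) atTop (𝓝 0) := by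
      simpa using (tendsto_iff_norm_sub_tendsto_zero.1 hk).mul_const C
    refine squeeze_zero_norm (fun n => ?_) h2
    exact (norm_inner_le_norm _ _).trans (by gcongr; exact hu n)
  have h3 := h1.add (hw k₀)
  rw [zero_add, real_inner_comm] at h3
  refine h3.congr fun n => ?_
  rw [inner_sub_left, real_inner_comm k₀ (u n)]
  ring

/-! ### Integral operators with positive kernels -/

/-- Bounded continuous symmetric kernels, positive off the coordinate axes. -/
structure IsPosKernel (K : ℝ → ℝ → ℝ) : Prop where
  continuous : Continuous (Function.uncurry K)
  symm : ∀ x y, K x y = K y x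
  nonneg : ∀ x y, 0 ≤ K x y
  pos : ∀ x y, x ≠ 0 → y ≠ 0 → 0 < K x y
  bdd : ∃ M, ∀ x y, K x y ≤ M

/-- The function `x ↦ ∫_{[-ξ, ξ]} K x y u y dy`. -/
noncomputable def kernelInt (K : ℝ → ℝ → ℝ) (ξ : ℝ) (u : ℝ → ℝ) (x : ℝ) : ℝ :=
  ∫ y in Icc (-ξ) ξ, K x y * u y

/-- The indicator function of `[-ξ, ξ]` in `L²`. -/
noncomputable def oneL2 (ξ : ℝ) : L2 :=
  indicatorConstLp 2 (measurableSet_Icc (a := -ξ) (b := ξ)) measure_Icc_lt_top.ne (1 : ℝ)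

theorem oneL2_coe (ξ : ℝ) : oneL2 ξ =ᵐ[volume] (Icc (-ξ) ξ).indicator fun _ => (1 : ℝ) :=
  indicatorConstLp_coeFn

theorem L2.integrableOn_Icc (u : L2) (ξ : ℝ) : IntegrableOn u (Icc (-ξ) ξ) :=
  ((Lp.memLp u).restrict _).integrable one_le_two

theorem L2.setIntegral_abs_le (u : L2) (ξ : ℝ) :
    ∫ y in Icc (-ξ) ξ, |u y| ≤ ‖oneL2 ξ‖ * ‖u‖ := by
  have h := real_inner_le_norm (oneL2 ξ) |u|
  rw [oneL2, L2.inner_indicatorConstLp_one, norm_abs_eq_norm] at h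
  refine le_trans (le_of_eq ?_) h
  refine integral_congr_ae (ae_restrict_of_ae ?_)
  filter_upwards [Lp.coeFn_abs u] with x hx
  exact hx.symm

namespace IsPosKernel

variable {K : ℝ → ℝ → ℝ} (hK : IsPosKernel K)

include hK

theorem continuous_right (x : ℝ) : Continuous (K x) :=
  hK.continuous.comp (Continuous.prodMk_right x)

theorem continuous_left (y : ℝ) : Continuous fun x => K x y :=
  hK.continuous.comp (Continuous.prodMk_left y)

theorem integrableOn_mul (u : ℝ → ℝ) (ξ : ℝ) (hu : IntegrableOn u (Icc (-ξ) ξ)) (x : ℝ) :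
    IntegrableOn (fun y => K x y * u y) (Icc (-ξ) ξ) := by
  obtain ⟨M, hM⟩ := hK.bdd
  refine Integrable.bdd_mul (c := M) hu (hK.continuous_right x).aestronglyMeasurable ?_
  refine Eventually.of_forall fun y => ?_
  rw [Real.norm_eq_abs, abs_of_nonneg (hK.nonneg x y)]
  exact hM x y

theorem continuous_kernelInt (u : ℝ → ℝ) (ξ : ℝ) (hu : IntegrableOn u (Icc (-ξ) ξ)) :
    Continuous (kernelInt K ξ u) := by
  obtain ⟨M, hM⟩ := hK.bdd
  refine continuous_of_dominated (bound := fun y => M * |u y|) ?_ ?_ ?_ ?_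
  · intro x
    exact (hK.integrableOn_mul u ξ hu x).aestronglyMeasurable
  · intro x
    refine Eventually.of_forall fun y => ?_
    rw [Real.norm_eq_abs, abs_mul, abs_of_nonneg (hK.nonneg x y)]
    gcongr
    exact hM x y
  · exact hu.abs.const_mul M
  · refine Eventually.of_forall fun y => ?_
    exact (hK.continuous_left y).mul continuous_const

/-- Cauchy–Schwarz against the indicator function. The constant does not depend on `ξ`, which
provides a common majorant when `ξ` varies. -/
theorem exists_kernelInt_bound :
    ∃ M, 0 ≤ M ∧ ∀ (u : L2) (ξ x : ℝ), |kernelInt K ξ u x| ≤ M * ‖oneL2 ξ‖ * ‖u‖ := by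
  obtain ⟨M, hM⟩ := hK.bdd
  have hM0 : 0 ≤ M := (hK.nonneg 0 0).trans (hM 0 0)
  refine ⟨M, hM0, fun u ξ x => ?_⟩
  calc |kernelInt K ξ u x| ≤ ∫ y in Icc (-ξ) ξ, |K x y * u y| := abs_integral_le_integral_abs
    _ ≤ ∫ y in Icc (-ξ) ξ, M * |u y| := by
        refine integral_mono (hK.integrableOn_mul u ξ (L2.integrableOn_Icc u ξ) x).abs
          ((L2.integrableOn_Icc u ξ).abs.const_mul M) fun y => ?_
        simp only [abs_mul, abs_of_nonneg (hK.nonneg x y)]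
        gcongr
        exact hM x y
    _ = M * ∫ y in Icc (-ξ) ξ, |u y| := integral_const_mul _ _
    _ ≤ M * (‖oneL2 ξ‖ * ‖u‖) := by gcongr; exact L2.setIntegral_abs_le u ξ
    _ = _ := by ring

theorem memLp_indicator_kernelInt (u : ℝ → ℝ) (ξ : ℝ) (hu : IntegrableOn u (Icc (-ξ) ξ)) :
    MemLp ((Icc (-ξ) ξ).indicator (kernelInt K ξ u)) 2 := by
  rw [memLp_indicator_iff_restrict measurableSet_Icc]
  have hc := hK.continuous_kernelInt u ξ hu
  obtain ⟨C, hC⟩ := isCompact_Icc.exists_bound_of_continuousOn hc.continuousOn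
  refine MemLp.of_bound hc.aestronglyMeasurable C ?_
  exact ae_restrict_of_forall_mem measurableSet_Icc hC

theorem kernelInt_add (ξ x : ℝ) (u v : L2) :
    kernelInt K ξ (u + v : L2) x = kernelInt K ξ u x + kernelInt K ξ v x := by
  simp only [kernelInt]
  rw [← integral_add (hK.integrableOn_mul u ξ (L2.integrableOn_Icc u ξ) x)
    (hK.integrableOn_mul v ξ (L2.integrableOn_Icc v ξ) x)]
  refine integral_congr_ae (ae_restrict_of_ae ?_)
  filter_upwards [Lp.coeFn_add u v] with y hy
  rw [hy, Pi.add_apply, mul_add]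

omit hK in
theorem kernelInt_smul (ξ x c : ℝ) (u : L2) :
    kernelInt K ξ (c • u : L2) x = c * kernelInt K ξ u x := by
  simp only [kernelInt]
  rw [← integral_const_mul]
  refine integral_congr_ae (ae_restrict_of_ae ?_)
  filter_upwards [Lp.coeFn_smul c u] with y hy
  rw [hy, Pi.smul_apply, smul_eq_mul]
  ring

/-- The operator `u ↦ χ_ξ · ∫_{[-ξ, ξ]} K · y u y dy` on `L²`. -/
noncomputable def op (ξ : ℝ) : L2 →L[ℝ] L2 :=
  LinearMap.mkContinuous
    { toFun := fun u => (hK.memLp_indicator_kernelInt u ξ (L2.integrableOn_Icc u ξ)).toLp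
      map_add' := fun u v => by
        rw [← MemLp.toLp_add]
        refine MemLp.toLp_congr _ _ (Eventually.of_forall fun x => ?_)
        by_cases h : x ∈ Icc (-ξ) ξ
        · simpa [h] using hK.kernelInt_add ξ x u v
        · simp [h]
      map_smul' := fun c u => by
        rw [RingHom.id_apply, ← MemLp.toLp_const_smul]
        refine MemLp.toLp_congr _ _ (Eventually.of_forall fun x => ?_)
        by_cases h : x ∈ Icc (-ξ) ξ
        · simp [h, kernelInt_smul]
        · simp [h] }
    (hK.exists_kernelInt_bound.choose * ‖oneL2 ξ‖ * ‖oneL2 ξ‖) fun u => by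
      have h := Lp.norm_le_mul_norm_of_ae_le_mul
        (f := (hK.memLp_indicator_kernelInt u ξ (L2.integrableOn_Icc u ξ)).toLp) (g := oneL2 ξ)
        (c := hK.exists_kernelInt_bound.choose * ‖oneL2 ξ‖ * ‖u‖) (by
          filter_upwards [MemLp.coeFn_toLp
            (hK.memLp_indicator_kernelInt u ξ (L2.integrableOn_Icc u ξ)), oneL2_coe ξ] with x h1 h2
          rw [h1, h2]
          by_cases hx : x ∈ Icc (-ξ) ξ
          · simpa [hx] using hK.exists_kernelInt_bound.choose_spec.2 u ξ x
          · simp [hx])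
      refine h.trans (le_of_eq ?_)
      ring

theorem op_coe (ξ : ℝ) (u : L2) :
    hK.op ξ u =ᵐ[volume] (Icc (-ξ) ξ).indicator (kernelInt K ξ u) :=
  MemLp.coeFn_toLp (hK.memLp_indicator_kernelInt u ξ (L2.integrableOn_Icc u ξ))

theorem inner_op (ξ : ℝ) (u w : L2) :
    ⟪hK.op ξ u, w⟫ = ∫ x in Icc (-ξ) ξ, ∫ y in Icc (-ξ) ξ, K x y * u y * w x := by
  rw [L2.inner_def, ← integral_indicator measurableSet_Icc]
  refine integral_congr_ae ?_
  filter_upwards [hK.op_coe ξ u] with x hx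
  rw [hx]
  by_cases h : x ∈ Icc (-ξ) ξ
  · simp only [h, indicator_of_mem, kernelInt]
    rw [integral_mul_const]
    simp [mul_comm]
  · simp [h]

theorem op_symm (ξ : ℝ) (u w : L2) : ⟪hK.op ξ u, w⟫ = ⟪u, hK.op ξ w⟫ := by
  rw [real_inner_comm (hK.op ξ w) u, hK.inner_op, hK.inner_op]
  rw [integral_integral_swap]
  · refine integral_congr_ae (Eventually.of_forall fun x => ?_)
    refine integral_congr_ae (Eventually.of_forall fun y => ?_)
    simp only [hK.symm y x]
    ring
  · obtain ⟨M, hM⟩ := hK.bdd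
    have h1 : Integrable (fun z : ℝ × ℝ => w z.1 * u z.2)
        ((volume.restrict (Icc (-ξ) ξ)).prod (volume.restrict (Icc (-ξ) ξ))) :=
      Integrable.mul_prod (L2.integrableOn_Icc w ξ) (L2.integrableOn_Icc u ξ)
    have h2 := Integrable.bdd_mul (c := M) h1 (f := Function.uncurry K)
      hK.continuous.aestronglyMeasurable (Eventually.of_forall fun z => by
        simp only [Function.uncurry, Real.norm_eq_abs, abs_of_nonneg (hK.nonneg _ _), hM])
    refine h2.congr (Eventually.of_forall fun z => ?_)
    simp only [Function.uncurry]
    ring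

theorem memLp_section (ξ x : ℝ) : MemLp ((Icc (-ξ) ξ).indicator (K x)) 2 := by
  rw [memLp_indicator_iff_restrict measurableSet_Icc]
  obtain ⟨M, hM⟩ := hK.bdd
  refine MemLp.of_bound (hK.continuous_right x).aestronglyMeasurable M ?_
  refine Eventually.of_forall fun y => ?_
  rw [Real.norm_eq_abs, abs_of_nonneg (hK.nonneg x y)]
  exact hM x y

/-- Makes point values of the image accessible to weak convergence of `u`. -/
theorem kernelInt_eq_inner (ξ x : ℝ) (u : L2) :
    kernelInt K ξ u x = ⟪(hK.memLp_section ξ x).toLp, u⟫ := by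
  rw [L2.inner_def, kernelInt, ← integral_indicator measurableSet_Icc]
  refine integral_congr_ae ?_
  filter_upwards [(hK.memLp_section ξ x).coeFn_toLp] with y hy
  rw [hy]
  by_cases h : y ∈ Icc (-ξ) ξ <;> simp [h, mul_comm]

omit hK in
theorem tendsto_indicator_Icc {s : ℕ → ℝ} {ξ : ℝ} (hs : Tendsto s atTop (𝓝 ξ)) {x : ℝ}
    (hx : |x| ≠ ξ) {f : ℕ → ℝ → ℝ} {g : ℝ → ℝ} (hf : Tendsto (fun n => f n x) atTop (𝓝 (g x))) :
    Tendsto (fun n => (Icc (-s n) (s n)).indicator (f n) x) atTop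
      (𝓝 ((Icc (-ξ) ξ).indicator g x)) := by
  rcases lt_or_gt_of_ne hx with h | h
  · have h1 : ∀ᶠ n in atTop, |x| < s n := hs.eventually_const_lt h
    rw [indicator_of_mem (show x ∈ Icc (-ξ) ξ from abs_le.1 h.le)]
    refine hf.congr' ?_
    filter_upwards [h1] with n hn
    rw [indicator_of_mem (show x ∈ Icc (-s n) (s n) from abs_le.1 hn.le)]
  · have h1 : ∀ᶠ n in atTop, s n < |x| := hs.eventually_lt_const h
    rw [indicator_of_notMem (show x ∉ Icc (-ξ) ξ from fun hh => h.not_ge (abs_le.2 hh))]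
    refine tendsto_const_nhds.congr' ?_
    filter_upwards [h1] with n hn
    rw [indicator_of_notMem (show x ∉ Icc (-s n) (s n) from fun hh => hn.not_ge (abs_le.2 hh))]

omit hK in
theorem ae_abs_ne (ξ : ℝ) : ∀ᵐ x : ℝ, |x| ≠ ξ := by
  have h : ({ξ, -ξ} : Set ℝ).Countable := (Set.finite_singleton _).insert _ |>.countable
  filter_upwards [h.ae_notMem volume] with x hx hh
  rcases abs_choice x with h1 | h1 <;> rw [h1] at hh <;> simp_all
  exact hx.2 (by linarith)

/-- Weakly convergent sequences are mapped to strongly convergent ones, even if `ξ` varies. -/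
theorem tendsto_op {s : ℕ → ℝ} {ξ C : ℝ} (hs : Tendsto s atTop (𝓝 ξ)) {u : ℕ → L2} {w : L2}
    (hu : ∀ n, ‖u n‖ ≤ C) (hw : ∀ z, Tendsto (fun n => ⟪u n, z⟫) atTop (𝓝 ⟪w, z⟫)) :
    Tendsto (fun n => hK.op (s n) (u n)) atTop (𝓝 (hK.op ξ w)) := by
  -- All intervals lie in one `[-R, R]`, so constants on it serve as majorants.
  obtain ⟨R, hR⟩ := hs.bddAbove_range
  replace hR : ∀ n, s n ≤ R := fun n => hR (mem_range_self n)
  have hsub : ∀ n, Icc (-s n) (s n) ⊆ Icc (-R) R := fun n =>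
    Icc_subset_Icc (neg_le_neg (hR n)) (hR n)
  obtain ⟨M, hM⟩ := hK.bdd
  have hM0 : 0 ≤ M := (hK.nonneg 0 0).trans (hM 0 0)
  obtain ⟨M', hM'0, hM'⟩ := hK.exists_kernelInt_bound
  have hone : ∀ c : ℝ, MemLp ((Icc (-R) R).indicator fun _ => c) 2 := fun c =>
    memLp_indicator_const 2 measurableSet_Icc c (Or.inr measure_Icc_lt_top.ne)
  have honele : ∀ n, ‖oneL2 (s n)‖ ≤ ‖oneL2 R‖ := fun n => by
    refine Lp.norm_le_norm_of_ae_le ?_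
    filter_upwards [oneL2_coe (s n), oneL2_coe R] with x h1 h2
    rw [h1, h2]
    by_cases h : x ∈ Icc (-s n) (s n)
    · rw [indicator_of_mem h, indicator_of_mem (hsub n h)]
    · rw [indicator_of_notMem h, norm_zero]
      exact norm_nonneg _
  have hC : 0 ≤ C := (norm_nonneg _).trans (hu 0)
  -- At fixed `x` the truncated sections of `K` converge strongly, and are paired with a weakly
  -- convergent sequence.
  have hptw : ∀ x, Tendsto (fun n => kernelInt K (s n) (u n) x) atTop
      (𝓝 (kernelInt K ξ w x)) := by
    intro x
    simp only [hK.kernelInt_eq_inner]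
    refine tendsto_inner_of_tendsto_of_weak ?_ hu hw
    refine tendsto_L2_of_dominated _ (hone M) (fun n => ?_) ?_
    · filter_upwards [(hK.memLp_section (s n) x).coeFn_toLp] with y hy
      rw [hy]
      by_cases h : y ∈ Icc (-s n) (s n)
      · rw [indicator_of_mem h, indicator_of_mem (hsub n h), abs_of_nonneg (hK.nonneg x y)]
        exact hM x y
      · rw [indicator_of_notMem h, abs_zero]
        exact indicator_nonneg (fun _ _ => hM0) _
    · have h1 := ae_all_iff.2 fun n => (hK.memLp_section (s n) x).coeFn_toLp
      filter_upwards [h1, (hK.memLp_section ξ x).coeFn_toLp, ae_abs_ne ξ] with y h1 h2 h3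
      rw [h2]
      simp only [h1]
      exact tendsto_indicator_Icc hs h3 tendsto_const_nhds
  refine tendsto_L2_of_dominated _ (hone (M' * ‖oneL2 R‖ * C)) (fun n => ?_) ?_
  · filter_upwards [hK.op_coe (s n) (u n)] with x hx
    rw [hx]
    by_cases h : x ∈ Icc (-s n) (s n)
    · rw [indicator_of_mem h, indicator_of_mem (hsub n h)]
      refine (hM' _ _ _).trans ?_
      gcongr
      · exact honele n
      · exact hu n
    · rw [indicator_of_notMem h, abs_zero]
      exact indicator_nonneg (fun _ _ => by positivity) _
  · have h1 := ae_all_iff.2 fun n => hK.op_coe (s n) (u n)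
    filter_upwards [h1, hK.op_coe ξ w, ae_abs_ne ξ] with x h1 h2 h3
    rw [h2]
    simp only [h1]
    exact tendsto_indicator_Icc hs h3 (hptw x)

end IsPosKernel

/-! ### Perron–Frobenius theory for positive kernels -/

theorem L2.inner_nonneg {u w : L2} (hu : 0 ≤ u) (hw : 0 ≤ w) : 0 ≤ ⟪u, w⟫ := by
  rw [L2.inner_def]
  refine integral_nonneg_of_ae ?_
  filter_upwards [(Lp.coeFn_nonneg u).2 hu, (Lp.coeFn_nonneg w).2 hw] with x h1 h2
  simpa using mul_nonneg h2 h1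

/-- A nonnegative function is zero if it is orthogonal to a nonnegative function that is positive
wherever the former is nonzero. -/
theorem L2.eq_zero_of_inner_eq_zero {u w : L2} (hu : 0 ≤ u) (hw : 0 ≤ w) (h0 : ⟪u, w⟫ = 0)
    (h : ∀ᵐ x, u x ≠ 0 → 0 < w x) : u = 0 := by
  rw [L2.inner_def] at h0
  rw [integral_eq_zero_iff_of_nonneg_ae ?_ (L2.integrable_inner u w)] at h0
  · rw [Lp.eq_zero_iff_ae_eq_zero]
    filter_upwards [h0, h] with x h1 h2
    by_contra h3
    have := (h2 h3).ne'
    simp_all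
  · filter_upwards [(Lp.coeFn_nonneg u).2 hu, (Lp.coeFn_nonneg w).2 hw] with x h1 h2
    simpa using mul_nonneg h2 h1

instance L2.separableSpace : TopologicalSpace.SeparableSpace L2 :=
  haveI : Fact ((2 : ENNReal) ≠ ⊤) := ⟨ENNReal.ofNat_ne_top⟩
  inferInstance

theorem volume_Icc_symm_pos {ξ : ℝ} (hξ : 0 < ξ) : 0 < volume (Icc (-ξ) ξ) := by
  rw [Real.volume_Icc]
  simp [hξ]

theorem exists_mem_Icc_of_ae {ξ : ℝ} (hξ : 0 < ξ) {p : ℝ → Prop} (hp : ∀ᵐ x, p x) :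
    ∃ x ∈ Icc (-ξ) ξ, p x := by
  by_contra! h
  have h1 : volume (Icc (-ξ) ξ) = 0 :=
    measure_mono_null (fun x hx => h x hx) hp
  exact (volume_Icc_symm_pos hξ).ne' h1

namespace IsPosKernel

variable {K : ℝ → ℝ → ℝ} (hK : IsPosKernel K)

include hK

theorem op_nonneg (ξ : ℝ) {u : L2} (hu : 0 ≤ u) : 0 ≤ hK.op ξ u := by
  rw [← Lp.coeFn_nonneg] at hu ⊢
  filter_upwards [hK.op_coe ξ u] with x hx
  rw [hx]
  refine indicator_nonneg (fun x _ => ?_) x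
  refine integral_nonneg_of_ae (ae_restrict_of_ae ?_)
  filter_upwards [hu] with y hy
  exact mul_nonneg (hK.nonneg x y) hy

theorem op_mono (ξ : ℝ) {u w : L2} (h : u ≤ w) : hK.op ξ u ≤ hK.op ξ w := by
  have := hK.op_nonneg ξ (sub_nonneg.2 h)
  rwa [map_sub, sub_nonneg] at this

theorem abs_op_le (ξ : ℝ) (u : L2) : |hK.op ξ u| ≤ hK.op ξ |u| := by
  refine abs_le'.2 ⟨hK.op_mono ξ (le_abs_self u), ?_⟩
  rw [← map_neg]
  exact hK.op_mono ξ (neg_le_abs u)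

/-- The operator improves positivity: for `x ≠ 0` the kernel can vanish only at `y = 0`, a null set.
-/
theorem kernelInt_pos {ξ : ℝ} {u : L2} (hu : 0 ≤ u) (hne : ¬ ∀ᵐ x, x ∈ Icc (-ξ) ξ → u x = 0)
    {x : ℝ} (hx : x ≠ 0) : 0 < kernelInt K ξ u x := by
  rw [← Lp.coeFn_nonneg] at hu
  have hn : 0 ≤ᵐ[volume.restrict (Icc (-ξ) ξ)] fun y => K x y * u y := by
    refine ae_restrict_of_ae ?_
    filter_upwards [hu] with y hy
    exact mul_nonneg (hK.nonneg x y) hy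
  refine lt_of_le_of_ne (integral_nonneg_of_ae hn) fun h => hne ?_
  rw [eq_comm, kernelInt, integral_eq_zero_iff_of_nonneg_ae hn
    (hK.integrableOn_mul u ξ (L2.integrableOn_Icc u ξ) x)] at h
  have h := (ae_restrict_iff' measurableSet_Icc).1 h
  filter_upwards [h, Measure.ae_ne volume 0] with y h1 h2 h3
  have := (hK.pos x y hx h2).ne'
  have := h1 h3
  simp_all

theorem kernelInt_pos_of_eigen {ξ μ : ℝ} (hμ : μ ≠ 0) {u : L2} (hu : 0 ≤ u) (hne : u ≠ 0)
    (h : hK.op ξ u = μ • u) {x : ℝ} (hx : x ≠ 0) : 0 < kernelInt K ξ u x := by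
  refine hK.kernelInt_pos hu (fun h0 => hne ?_) hx
  rw [Lp.eq_zero_iff_ae_eq_zero]
  have h1 := hK.op_coe ξ u
  rw [h] at h1
  filter_upwards [h0, h1, Lp.coeFn_smul μ u] with y h1 h2 h3
  by_cases hy : y ∈ Icc (-ξ) ξ
  · exact h1 hy
  · rw [h3, indicator_of_notMem hy] at h2
    simpa [hμ] using h2

/-- Dividing the eigenvalue equation by `μ` gives a representative that is continuous on the
interval and zero outside; pointwise information on eigenfunctions comes from it. -/
theorem eigen_coe {ξ μ : ℝ} (hμ : μ ≠ 0) {u : L2} (h : hK.op ξ u = μ • u) :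
    u =ᵐ[volume] (Icc (-ξ) ξ).indicator fun x => μ⁻¹ * kernelInt K ξ u x := by
  have h1 := hK.op_coe ξ u
  rw [h] at h1
  filter_upwards [h1, Lp.coeFn_smul μ u] with x h1 h2
  rw [h2, Pi.smul_apply, smul_eq_mul] at h1
  by_cases hx : x ∈ Icc (-ξ) ξ <;> simp only [hx, indicator_of_mem, not_false_eq_true,
    indicator_of_notMem] at h1 ⊢
  · rw [← h1]
    field_simp
  · simpa [hμ] using h1

theorem eigen_pos {ξ μ : ℝ} (hμ : 0 < μ) {u : L2} (hu : 0 ≤ u) (hne : u ≠ 0)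
    (h : hK.op ξ u = μ • u) : ∀ᵐ x, x ∈ Icc (-ξ) ξ → 0 < u x := by
  filter_upwards [hK.eigen_coe hμ.ne' h, Measure.ae_ne volume 0] with x h1 h2 h3
  rw [h1, indicator_of_mem h3]
  exact mul_pos (inv_pos.2 hμ) (hK.kernelInt_pos_of_eigen hμ.ne' hu hne h h2)

theorem eigen_eq_zero {ξ μ : ℝ} (hμ : μ ≠ 0) {u : L2} (h : hK.op ξ u = μ • u) :
    ∀ᵐ x, x ∉ Icc (-ξ) ξ → u x = 0 := by
  filter_upwards [hK.eigen_coe hμ h] with x h1 h3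
  rw [h1, indicator_of_notMem h3]

theorem norm_op_pos {ξ : ℝ} (hξ : 0 < ξ) : 0 < ‖hK.op ξ‖ := by
  rw [norm_pos_iff]
  intro h
  have h0 : (0 : L2) ≤ oneL2 ξ := by
    rw [← Lp.coeFn_nonneg]
    filter_upwards [oneL2_coe ξ] with x hx
    rw [hx]
    exact indicator_nonneg (fun _ _ => zero_le_one) _
  have h1 := hK.op_coe ξ (oneL2 ξ)
  rw [h, zero_apply] at h1
  obtain ⟨x, hx, h2, h3, h4⟩ := exists_mem_Icc_of_ae hξ
    (h1.and ((Lp.coeFn_zero ℝ 2 volume).and (Measure.ae_ne volume (0 : ℝ))))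
  rw [h3, indicator_of_mem hx] at h2
  refine (hK.kernelInt_pos h0 (fun hh => ?_) h4).ne h2
  obtain ⟨y, hy, h5, h6⟩ := exists_mem_Icc_of_ae hξ (hh.and (oneL2_coe ξ))
  rw [h5 hy, indicator_of_mem hy] at h6
  exact zero_ne_one h6

/-- A maximizing sequence for the norm can be taken nonnegative. By symmetry it asymptotically
solves `E² u = Λ² u`, and compactness turns it into a strongly convergent one with limit `p`.
Factoring `E² - Λ²` then yields an eigenfunction to `Λ` itself. -/
theorem exists_nonneg_eigen {ξ : ℝ} (hξ : 0 < ξ) :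
    ∃ u : L2, 0 ≤ u ∧ ‖u‖ = 1 ∧ hK.op ξ u = ‖hK.op ξ‖ • u := by
  set E := hK.op ξ with hE
  set Λ := ‖E‖ with hΛdef
  have hΛ : 0 < Λ := hK.norm_op_pos hξ
  have hmax : ∀ n : ℕ, ∃ u : L2, 0 ≤ u ∧ ‖u‖ ≤ 1 ∧ Λ - 1 / ((n : ℝ) + 1) < ‖E u‖ := by
    intro n
    obtain ⟨x, hx1, hx2⟩ := ContinuousLinearMap.exists_lt_apply_of_lt_opNorm E
      (show Λ - 1 / ((n : ℝ) + 1) < ‖E‖ from sub_lt_self _ (by positivity))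
    refine ⟨|x|, abs_nonneg x, by rw [norm_abs_eq_norm]; exact hx1.le, hx2.trans_le ?_⟩
    -- Passing from `x` to `|x|` does not decrease the norm of the image, since `|E x| ≤ E |x|`.
    refine norm_le_norm_of_abs_le_abs ?_
    exact (hK.abs_op_le ξ x).trans (le_abs_self _)
  choose u hu0 hu1 hu2 using hmax
  have hle : ∀ n, ‖E (u n)‖ ≤ Λ := fun n => by
    simpa using E.le_opNorm_of_le (hu1 n)
  have hlim : Tendsto (fun n => ‖E (u n)‖) atTop (𝓝 Λ) := by
    refine tendsto_of_tendsto_of_tendsto_of_le_of_le ?_ tendsto_const_nhds (fun n => (hu2 n).le) hle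
    simpa using tendsto_one_div_add_atTop_nhds_zero_nat.const_sub Λ
  -- Expanding the square, symmetry makes the mixed term `-2 Λ² ‖E u‖²`, while the outer terms are
  -- at most `Λ² ‖E u‖²` and `Λ⁴`.
  have hdef : ∀ n, ‖E (E (u n)) - Λ ^ 2 • u n‖ ^ 2 ≤ Λ ^ 2 * (Λ ^ 2 - ‖E (u n)‖ ^ 2) := by
    intro n
    rw [norm_sub_sq_real, real_inner_smul_right, hK.op_symm, real_inner_self_eq_norm_sq,
      norm_smul, Real.norm_of_nonneg (by positivity)]
    have h1 : ‖E (E (u n))‖ ^ 2 ≤ Λ ^ 2 * ‖E (u n)‖ ^ 2 := by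
      rw [← mul_pow]
      gcongr
      exact E.le_opNorm _
    have h2 : (Λ ^ 2 * ‖u n‖) ^ 2 ≤ (Λ ^ 2 * 1) ^ 2 := by
      gcongr
      exact hu1 n
    nlinarith
  have hdef0 : Tendsto (fun n => E (E (u n)) - Λ ^ 2 • u n) atTop (𝓝 0) := by
    rw [tendsto_zero_iff_norm_tendsto_zero]
    have h1 : Tendsto (fun n => Λ ^ 2 * (Λ ^ 2 - ‖E (u n)‖ ^ 2)) atTop (𝓝 0) := by
      rw [show (0 : ℝ) = Λ ^ 2 * (Λ ^ 2 - Λ ^ 2) by ring]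
      exact ((hlim.pow 2).const_sub (Λ ^ 2)).const_mul (Λ ^ 2)
    have h2 := (squeeze_zero (fun n => sq_nonneg _) hdef h1).sqrt
    simpa using h2
  obtain ⟨w, φ, hφ, hw⟩ := exists_subseq_tendsto_inner hu1
  have hEw : Tendsto (fun n => E (u (φ n))) atTop (𝓝 (E w)) :=
    hK.tendsto_op (s := fun _ => ξ) tendsto_const_nhds (fun n => hu1 (φ n)) hw
  have hEEw : Tendsto (fun n => E (E (u (φ n)))) atTop (𝓝 (E (E w))) :=
    (E.continuous.tendsto _).comp hEw
  set p : L2 := (Λ ^ 2)⁻¹ • E (E w) with hp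
  have hup : Tendsto (fun n => u (φ n)) atTop (𝓝 p) := by
    have h1 := (hEEw.sub (hdef0.comp hφ.tendsto_atTop)).const_smul (Λ ^ 2)⁻¹
    rw [sub_zero] at h1
    refine h1.congr fun n => ?_
    simp only [Function.comp_apply, sub_sub_cancel]
    rw [smul_smul, inv_mul_cancel₀ (by positivity), one_smul]
  have hEp : Tendsto (fun n => E (u (φ n))) atTop (𝓝 (E p)) := (E.continuous.tendsto _).comp hup
  have hEEp : E (E p) = Λ ^ 2 • p := by
    have h1 : Tendsto (fun n => E (E (u (φ n)))) atTop (𝓝 (E (E p))) :=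
      (E.continuous.tendsto _).comp hEp
    rw [tendsto_nhds_unique h1 hEEw, hp, smul_smul, mul_inv_cancel₀ (by positivity), one_smul]
  have hnorm : ‖E p‖ = Λ := tendsto_nhds_unique hEp.norm (hlim.comp hφ.tendsto_atTop)
  have hp0 : 0 ≤ p := isClosed_nonneg.mem_of_tendsto hup
    (Eventually.of_forall fun n => hu0 (φ n))
  have hEp0 : 0 ≤ E p := hK.op_nonneg ξ hp0
  have hpne : p ≠ 0 := by
    intro h
    rw [h, map_zero, norm_zero] at hnorm
    exact hΛ.ne hnorm
  have hΛp : 0 ≤ Λ • p := by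
    rw [← Lp.coeFn_nonneg] at hp0 ⊢
    filter_upwards [hp0, Lp.coeFn_smul Λ p] with x h1 h2
    rw [h2]
    exact mul_nonneg hΛ.le h1
  clear_value p
  -- `(E - Λ) (E + Λ) p = 0`, so `z` is an eigenfunction once it is nonzero. Nonnegativity excludes
  -- cancellation between its two summands.
  set z := E p + Λ • p with hz
  have hz0 : 0 ≤ z := add_nonneg hEp0 hΛp
  have hzne : z ≠ 0 := by
    intro h
    have h1 : Λ • p = 0 := le_antisymm (by rw [← h]; exact le_add_of_nonneg_left hEp0) hΛp
    rw [smul_eq_zero] at h1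
    exact h1.elim hΛ.ne' hpne
  have hEz : E z = Λ • z := by
    rw [hz, map_add, map_smul, hEEp, smul_add, smul_smul, ← sq, add_comm]
  have hnz : 0 < ‖z‖⁻¹ := inv_pos.2 (norm_pos_iff.2 hzne)
  refine ⟨‖z‖⁻¹ • z, ?_, ?_, ?_⟩
  · rw [← Lp.coeFn_nonneg] at hz0 ⊢
    filter_upwards [hz0, Lp.coeFn_smul ‖z‖⁻¹ z] with x h1 h2
    rw [h2]
    exact mul_nonneg hnz.le h1
  · exact norm_smul_inv_norm hzne
  · rw [map_smul, hEz, smul_comm]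

/-- The normalized nonnegative eigenfunction of `op ξ` to the eigenvalue `‖op ξ‖`. -/
noncomputable def perron (ξ : ℝ) : L2 :=
  Classical.epsilon fun u : L2 => 0 ≤ u ∧ ‖u‖ = 1 ∧ hK.op ξ u = ‖hK.op ξ‖ • u

section

variable {ξ : ℝ} (hξ : 0 < ξ)

include hξ

theorem perron_spec :
    0 ≤ hK.perron ξ ∧ ‖hK.perron ξ‖ = 1 ∧ hK.op ξ (hK.perron ξ) = ‖hK.op ξ‖ • hK.perron ξ :=
  Classical.epsilon_spec (hK.exists_nonneg_eigen hξ)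

theorem perron_ne_zero : hK.perron ξ ≠ 0 := by
  rw [← norm_pos_iff, (hK.perron_spec hξ).2.1]
  exact one_pos

theorem perron_pos : ∀ᵐ x, x ∈ Icc (-ξ) ξ → 0 < hK.perron ξ x :=
  hK.eigen_pos (hK.norm_op_pos hξ) (hK.perron_spec hξ).1 (hK.perron_ne_zero hξ)
    (hK.perron_spec hξ).2.2

/-- The Perron function is positive almost everywhere on the interval that carries `u`. The
uniqueness arguments below reduce to this. -/
theorem eq_zero_of_inner_perron {u : L2} (hu : 0 ≤ u) (h : ∀ᵐ x, x ∉ Icc (-ξ) ξ → u x = 0)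
    (h0 : ⟪u, hK.perron ξ⟫ = 0) : u = 0 := by
  refine L2.eq_zero_of_inner_eq_zero hu (hK.perron_spec hξ).1 h0 ?_
  filter_upwards [h, hK.perron_pos hξ] with x h1 h2 h3
  exact h2 (not_imp_comm.1 h1 h3)

/-- A nonnegative eigenfunction to a positive eigenvalue belongs to the largest eigenvalue. -/
theorem eigenvalue_eq_of_nonneg {μ : ℝ} (hμ : 0 < μ) {u : L2} (hu : 0 ≤ u) (hne : u ≠ 0)
    (h : hK.op ξ u = μ • u) : μ = ‖hK.op ξ‖ := by
  have h1 := hK.op_symm ξ u (hK.perron ξ)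
  rw [h, (hK.perron_spec hξ).2.2, real_inner_smul_left, real_inner_smul_right] at h1
  refine mul_right_cancel₀ (fun h0 => hne ?_) h1
  exact hK.eq_zero_of_inner_perron hξ hu (hK.eigen_eq_zero hμ.ne' h) h0

/-- Since `Λ |w| = |E w| ≤ E |w|`, the difference `E |w| - Λ |w|` is nonnegative. By symmetry it is
orthogonal to the Perron function, hence zero. -/
theorem abs_eigen {w : L2} (h : hK.op ξ w = ‖hK.op ξ‖ • w) :
    hK.op ξ |w| = ‖hK.op ξ‖ • |w| := by
  have hΛ := hK.norm_op_pos hξ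
  rw [← sub_eq_zero]
  have habs : |hK.op ξ w| = ‖hK.op ξ‖ • |w| := by
    rw [h]
    refine Lp.ext ?_
    filter_upwards [Lp.coeFn_abs (‖hK.op ξ‖ • w), Lp.coeFn_smul ‖hK.op ξ‖ w,
      Lp.coeFn_smul ‖hK.op ξ‖ |w|, Lp.coeFn_abs w] with x h1 h2 h3 h4
    rw [h1, h2, h3, Pi.smul_apply, Pi.smul_apply, h4, smul_eq_mul, smul_eq_mul, abs_mul,
      abs_of_pos hΛ]
  refine hK.eq_zero_of_inner_perron hξ ?_ ?_ ?_
  · rw [sub_nonneg, ← habs]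
    exact hK.abs_op_le ξ w
  · filter_upwards [hK.op_coe ξ |w|, hK.eigen_eq_zero hΛ.ne' h, Lp.coeFn_abs w,
      Lp.coeFn_smul ‖hK.op ξ‖ |w|, Lp.coeFn_sub (hK.op ξ |w|) (‖hK.op ξ‖ • |w|)]
      with x h1 h2 h3 h4 h5 hx
    rw [h5, Pi.sub_apply, h1, h4, Pi.smul_apply, h3, h2 hx, indicator_of_notMem hx]
    simp
  · rw [inner_sub_left, hK.op_symm, (hK.perron_spec hξ).2.2, real_inner_smul_left,
      real_inner_smul_right, sub_self]

/-- Otherwise `|w| + w` and `|w| - w` are nonzero nonnegative eigenfunctions, hence both positive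
almost everywhere on the interval; but at each point one of them vanishes. -/
theorem eigen_nonneg_or_nonpos {w : L2} (h : hK.op ξ w = ‖hK.op ξ‖ • w) : 0 ≤ w ∨ w ≤ 0 := by
  have hΛ := hK.norm_op_pos hξ
  have ha := hK.abs_eigen hξ h
  by_contra! hcon
  have h1 : |w| + w ≠ 0 := fun h0 => hcon.2 (by
    rw [← neg_eq_of_add_eq_zero_right h0]
    exact neg_nonpos.2 (abs_nonneg w))
  have h2 : |w| - w ≠ 0 := fun h0 => hcon.1 (by
    rw [← sub_eq_zero.1 h0]
    exact abs_nonneg w)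
  have h3 := hK.eigen_pos hΛ
    (by simpa [sub_eq_add_neg, add_comm] using sub_nonneg.2 (neg_le_abs w)) h1
    (show hK.op ξ (|w| + w) = ‖hK.op ξ‖ • (|w| + w) by rw [map_add, h, ha, smul_add])
  have h4 := hK.eigen_pos hΛ (sub_nonneg.2 (le_abs_self w)) h2
    (show hK.op ξ (|w| - w) = ‖hK.op ξ‖ • (|w| - w) by rw [map_sub, h, ha, smul_sub])
  obtain ⟨x, hx, h5, h6, h7, h8, h9⟩ := exists_mem_Icc_of_ae hξ (h3.and (h4.and
    ((Lp.coeFn_add |w| w).and ((Lp.coeFn_sub |w| w).and (Lp.coeFn_abs w)))))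
  have h5 := h5 hx
  have h6 := h6 hx
  simp only [h7, h8, Pi.add_apply, Pi.sub_apply, h9] at h5 h6
  rcases abs_choice (w x) with hc | hc <;> rw [hc] at h5 h6 <;> linarith

/-- The largest eigenvalue is simple. -/
theorem eigen_eq_smul_perron {w : L2} (h : hK.op ξ w = ‖hK.op ξ‖ • w) :
    w = ⟪w, hK.perron ξ⟫ • hK.perron ξ := by
  have hΛ := hK.norm_op_pos hξ
  obtain ⟨-, h1, hu⟩ := hK.perron_spec hξ
  -- An eigenfunction orthogonal to the Perron function still has a fixed sign, and therefore
  -- vanishes.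
  set d := w - ⟪w, hK.perron ξ⟫ • hK.perron ξ with hd
  have hdE : hK.op ξ d = ‖hK.op ξ‖ • d := by
    rw [hd, map_sub, map_smul, h, hu, smul_sub, smul_comm]
  have hd0 : ⟪d, hK.perron ξ⟫ = 0 := by
    rw [hd, inner_sub_left, real_inner_smul_left, real_inner_self_eq_norm_sq, h1]
    ring
  suffices d = 0 from sub_eq_zero.1 this
  rcases hK.eigen_nonneg_or_nonpos hξ hdE with hs | hs
  · exact hK.eq_zero_of_inner_perron hξ hs (hK.eigen_eq_zero hΛ.ne' hdE) hd0
  · refine neg_eq_zero.1 (hK.eq_zero_of_inner_perron hξ (neg_nonneg.2 hs)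
      (hK.eigen_eq_zero hΛ.ne' (by rw [map_neg, hdE, smul_neg])) ?_)
    rw [inner_neg_left, hd0, neg_zero]

theorem eq_perron {w : L2} (h0 : 0 ≤ w) (h1 : ‖w‖ = 1) (h : hK.op ξ w = ‖hK.op ξ‖ • w) :
    w = hK.perron ξ := by
  have h2 := hK.eigen_eq_smul_perron hξ h
  have h3 := congrArg norm h2
  rw [norm_smul, h1, (hK.perron_spec hξ).2.1, mul_one,
    Real.norm_of_nonneg (L2.inner_nonneg h0 (hK.perron_spec hξ).1)] at h3
  rwa [← h3, one_smul] at h2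

end

/-! ### Dependence of the largest eigenvalue and its eigenfunction on the interval -/

/-- With Perron functions `u` for `η` and `w` for `ξ`, the defect `op ξ u - ‖op η‖ • u` is supported
in `η < |x| ≤ ξ` and positive there. Pairing it with `w` gives `(‖op ξ‖ - ‖op η‖) * ⟪u, w⟫ > 0`. -/
theorem norm_op_lt {η ξ : ℝ} (hη : 0 < η) (h : η < ξ) : ‖hK.op η‖ < ‖hK.op ξ‖ := by
  have hξ := hη.trans h
  obtain ⟨hu0, -, hu⟩ := hK.perron_spec hη
  obtain ⟨hw0, -, hw⟩ := hK.perron_spec hξ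
  set u := hK.perron η
  set w := hK.perron ξ
  have hΛ := hK.norm_op_pos hη
  have hsub : Icc (-η) η ⊆ Icc (-ξ) ξ := Icc_subset_Icc (neg_le_neg h.le) h.le
  have hout := hK.eigen_eq_zero hΛ.ne' hu
  have hint : ∀ x, kernelInt K ξ u x = kernelInt K η u x := by
    intro x
    refine (setIntegral_eq_of_subset_of_ae_sdiff_eq_zero nullMeasurableSet_Icc hsub ?_)
    filter_upwards [hout] with y hy hy2
    rw [hy hy2.2, mul_zero]
  set d := hK.op ξ u - ‖hK.op η‖ • u with hd
  have hdcoe : d =ᵐ[volume] (Icc (-ξ) ξ \ Icc (-η) η).indicator (kernelInt K η u) := by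
    have h1 := hK.op_coe η u
    rw [hu] at h1
    filter_upwards [h1, hK.op_coe ξ u, Lp.coeFn_sub (hK.op ξ u) (‖hK.op η‖ • u)] with x h1 h2 h3
    rw [h3, Pi.sub_apply, h1, h2]
    by_cases hx : x ∈ Icc (-η) η
    · rw [indicator_of_mem hx, indicator_of_mem (hsub hx), hint, sub_self,
        indicator_of_notMem fun hh => hh.2 hx]
    · by_cases hx2 : x ∈ Icc (-ξ) ξ
      · rw [indicator_of_mem hx2, indicator_of_notMem hx,
          indicator_of_mem (mem_sdiff_of_mem hx2 hx), hint, sub_zero]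
      · rw [indicator_of_notMem hx2, indicator_of_notMem hx,
          indicator_of_notMem (fun hh => hx2 hh.1), sub_zero]
  have hpos : ∀ x, x ≠ 0 → 0 < kernelInt K η u x := fun x hx =>
    hK.kernelInt_pos_of_eigen hΛ.ne' hu0 (hK.perron_ne_zero hη) hu hx
  have hd0 : 0 ≤ d := by
    rw [← Lp.coeFn_nonneg]
    filter_upwards [hdcoe, Measure.ae_ne volume (0 : ℝ)] with x h1 h2
    rw [h1, Pi.zero_apply, indicator_apply]
    split_ifs
    exacts [(hpos x h2).le, le_rfl]
  have hdne : d ≠ 0 := by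
    intro h0
    rw [Lp.eq_zero_iff_ae_eq_zero] at h0
    have h1 : volume (Ioo η ξ) = 0 := by
      refine measure_mono_null (fun x hx => ?_) (h0.and hdcoe)
      rintro ⟨h2, h3⟩
      rw [h2, indicator_of_mem (show x ∈ Icc (-ξ) ξ \ Icc (-η) η from
        ⟨⟨by linarith [hx.1], hx.2.le⟩, fun hh => hx.1.not_ge hh.2⟩)] at h3
      exact (hpos x (hη.trans hx.1).ne').ne h3
    rw [Real.volume_Ioo] at h1
    simp [h.not_ge] at h1
  have hdw : 0 < ⟪d, w⟫ := by
    refine lt_of_le_of_ne (L2.inner_nonneg hd0 hw0) fun h0 => hdne ?_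
    refine hK.eq_zero_of_inner_perron hξ hd0 ?_ h0.symm
    filter_upwards [hdcoe] with x h1 h2
    rw [h1, indicator_of_notMem fun hh => h2 hh.1]
  rw [hd, inner_sub_left, hK.op_symm, hw, real_inner_smul_left, real_inner_smul_right,
    ← sub_mul] at hdw
  have := pos_of_mul_pos_left hdw (L2.inner_nonneg hu0 hw0)
  linarith

/-- Sequential continuity of the largest eigenvalue and its eigenfunction, along a subsequence. -/
theorem exists_subseq_tendsto_perron {s : ℕ → ℝ} {ξ : ℝ} (hξ : 0 < ξ)
    (hs : Tendsto s atTop (𝓝 ξ)) (h1 : ∀ n, ξ / 2 < s n) (h2 : ∀ n, s n < 2 * ξ) :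
    ∃ φ : ℕ → ℕ, StrictMono φ ∧
      Tendsto (fun n => ‖hK.op (s (φ n))‖) atTop (𝓝 ‖hK.op ξ‖) ∧
      Tendsto (fun n => hK.perron (s (φ n))) atTop (𝓝 (hK.perron ξ)) := by
  have hs0 : ∀ n, 0 < s n := fun n => (half_pos hξ).trans (h1 n)
  -- Monotonicity confines the eigenvalues to a compact interval away from zero, so the limit `l`
  -- can be inverted.
  obtain ⟨l, ⟨hl1, -⟩, φ, hφ, hl⟩ := (isCompact_Icc (a := ‖hK.op (ξ / 2)‖)
    (b := ‖hK.op (2 * ξ)‖)).tendsto_subseq (x := fun n => ‖hK.op (s n)‖)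
    (fun n => ⟨(hK.norm_op_lt (half_pos hξ) (h1 n)).le, (hK.norm_op_lt (hs0 n) (h2 n)).le⟩)
  have hl0 : 0 < l := (hK.norm_op_pos (half_pos hξ)).trans_le hl1
  have hbd : ∀ n, ‖hK.perron (s (φ n))‖ ≤ 1 := fun n => (hK.perron_spec (hs0 _)).2.1.le
  obtain ⟨w, ψ, hψ, hw⟩ := exists_subseq_tendsto_inner hbd
  have hφψ : Tendsto (fun n => s (φ (ψ n))) atTop (𝓝 ξ) :=
    hs.comp (hφ.tendsto_atTop.comp hψ.tendsto_atTop)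
  have hl' : Tendsto (fun n => ‖hK.op (s (φ (ψ n)))‖) atTop (𝓝 l) := hl.comp hψ.tendsto_atTop
  -- Writing each Perron function as its own image divided by the eigenvalue upgrades weak to strong
  -- convergence.
  have hlim : Tendsto (fun n => hK.perron (s (φ (ψ n)))) atTop (𝓝 (l⁻¹ • hK.op ξ w)) := by
    refine ((hl'.inv₀ hl0.ne').smul (hK.tendsto_op hφψ (fun n => hbd (ψ n)) hw)).congr fun n => ?_
    rw [(hK.perron_spec (hs0 _)).2.2, smul_smul, inv_mul_cancel₀ (hK.norm_op_pos (hs0 _)).ne',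
      one_smul]
  set p := l⁻¹ • hK.op ξ w
  have hp0 : 0 ≤ p := isClosed_nonneg.mem_of_tendsto hlim
    (Eventually.of_forall fun n => (hK.perron_spec (hs0 _)).1)
  have hp1 : ‖p‖ = 1 := by
    refine tendsto_nhds_unique hlim.norm ?_
    simp only [(hK.perron_spec (hs0 _)).2.1, tendsto_const_nhds]
  have hEp : hK.op ξ p = l • p := by
    have h3 := hK.tendsto_op hφψ (fun n => hbd (ψ n)) (w := p)
      (fun z => hlim.inner tendsto_const_nhds)
    refine tendsto_nhds_unique h3 ((hl'.smul hlim).congr fun n => ?_)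
    rw [(hK.perron_spec (hs0 _)).2.2]
  have hpne : p ≠ 0 := by
    rw [← norm_pos_iff, hp1]
    exact one_pos
  have hleq := hK.eigenvalue_eq_of_nonneg hξ hl0 hp0 hpne hEp
  have hpeq := hK.eq_perron hξ hp0 hp1 (by rw [hEp, hleq])
  rw [hleq] at hl'
  rw [hpeq] at hlim
  exact ⟨φ ∘ ψ, hφ.comp hψ, hl', hlim⟩

theorem continuousOn_norm_op_perron :
    ContinuousOn (fun ξ => (‖hK.op ξ‖, hK.perron ξ)) (Ioi 0) := by
  intro ξ hξ
  refine tendsto_of_subseq_tendsto fun ns hns => ?_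
  have hξ : 0 < ξ := hξ
  have hns := hns.mono_right nhdsWithin_le_nhds
  have h1 : ∀ᶠ n in atTop, ξ / 2 < ns n := hns.eventually_const_lt (half_lt_self hξ)
  have h2 : ∀ᶠ n in atTop, ns n < 2 * ξ := hns.eventually_lt_const (by linarith)
  obtain ⟨N, hN⟩ := eventually_atTop.1 (h1.and h2)
  obtain ⟨φ, -, h3, h4⟩ := hK.exists_subseq_tendsto_perron hξ
    (hns.comp (tendsto_add_atTop_nat N)) (fun n => (hN (n + N) (by omega)).1)
    (fun n => (hN (n + N) (by omega)).2)
  exact ⟨fun n => φ n + N, h3.prodMk_nhds h4⟩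

/-! ### Row integral bounds for the largest eigenvalue -/

/-- The largest eigenvalue is bounded by the maximal row integral. -/
theorem norm_op_le {ξ B : ℝ} (hξ : 0 < ξ)
    (hB : ∀ x ∈ Icc (-ξ) ξ, ∫ y in Icc (-ξ) ξ, K x y ≤ B) : ‖hK.op ξ‖ ≤ B := by
  obtain ⟨hu0, -, hu⟩ := hK.perron_spec hξ
  have hΛ := hK.norm_op_pos hξ
  set u := hK.perron ξ
  set Λ := ‖hK.op ξ‖
  have hpos : ∀ x, x ≠ 0 → 0 < kernelInt K ξ u x := fun x hx =>
    hK.kernelInt_pos_of_eigen hΛ.ne' hu0 (hK.perron_ne_zero hξ) hu hx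
  -- The eigenvalue equation is evaluated where the continuous representative is maximal.
  obtain ⟨x₀, hx₀, hmax⟩ := (isCompact_Icc (a := -ξ) (b := ξ)).exists_isMaxOn
    ⟨ξ, by linarith, le_rfl⟩
    (hK.continuous_kernelInt u ξ (L2.integrableOn_Icc u ξ)).continuousOn
  have hF : 0 < kernelInt K ξ u x₀ :=
    (hpos ξ hξ.ne').trans_le (hmax (show ξ ∈ Icc (-ξ) ξ from ⟨by linarith, le_rfl⟩))
  have hint : IntegrableOn (K x₀) (Icc (-ξ) ξ) :=
    (hK.continuous_right x₀).integrableOn_Icc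
  have h1 : kernelInt K ξ u x₀ ≤ ∫ y in Icc (-ξ) ξ, K x₀ y * (Λ⁻¹ * kernelInt K ξ u x₀) := by
    refine integral_mono_ae (hK.integrableOn_mul u ξ (L2.integrableOn_Icc u ξ) x₀)
      (hint.mul_const _) ?_
    rw [EventuallyLE, ae_restrict_iff' measurableSet_Icc]
    filter_upwards [hK.eigen_coe hΛ.ne' hu] with y hy hyI
    rw [hy, indicator_of_mem hyI]
    have := hK.nonneg x₀ y
    have := hmax hyI
    simp only [mem_ofPred_eq] at this
    gcongr
  rw [integral_mul_const] at h1
  have h2 : Λ * kernelInt K ξ u x₀ ≤ B * kernelInt K ξ u x₀ := by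
    calc Λ * kernelInt K ξ u x₀
        ≤ Λ * ((∫ y in Icc (-ξ) ξ, K x₀ y) * (Λ⁻¹ * kernelInt K ξ u x₀)) := by gcongr
      _ = (∫ y in Icc (-ξ) ξ, K x₀ y) * kernelInt K ξ u x₀ := by field_simp
      _ ≤ _ := by gcongr; exact hB x₀ hx₀
  exact le_of_mul_le_mul_right h2 hF

omit hK in
theorem norm_oneL2_sq {ξ : ℝ} (hξ : 0 < ξ) : ‖oneL2 ξ‖ ^ 2 = 2 * ξ := by
  rw [← real_inner_self_eq_norm_sq, oneL2,
    L2.real_inner_indicatorConstLp_one_indicatorConstLp_one measurableSet_Icc measurableSet_Icc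
      measure_Icc_lt_top.ne measure_Icc_lt_top.ne, inter_self, Real.volume_real_Icc]
  rw [max_eq_left (by linarith)]
  ring

/-- The Rayleigh quotient of the indicator function of the interval. -/
theorem integral_integral_le {ξ : ℝ} (hξ : 0 < ξ) :
    ∫ x in Icc (-ξ) ξ, ∫ y in Icc (-ξ) ξ, K x y ≤ ‖hK.op ξ‖ * (2 * ξ) := by
  have h1 : ⟪hK.op ξ (oneL2 ξ), oneL2 ξ⟫ ≤ ‖hK.op ξ‖ * (2 * ξ) := by
    refine (real_inner_le_norm _ _).trans ?_
    rw [← norm_oneL2_sq hξ, sq, ← mul_assoc]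
    gcongr
    exact ContinuousLinearMap.le_opNorm _ _
  refine le_trans (le_of_eq ?_) h1
  rw [hK.inner_op]
  have h2 : ∀ᵐ x ∂volume.restrict (Icc (-ξ) ξ), oneL2 ξ x = 1 := by
    rw [ae_restrict_iff' measurableSet_Icc]
    filter_upwards [oneL2_coe ξ] with x hx hxI
    rw [hx, indicator_of_mem hxI]
  refine integral_congr_ae ?_
  filter_upwards [h2] with x hx
  refine integral_congr_ae ?_
  filter_upwards [h2] with y hy
  rw [hx, hy, mul_one, mul_one]

end IsPosKernel

namespace IsKernel

variable {a : ℝ → ℝ} (ha : IsKernel a)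

include ha

/-! ### Pointwise properties of the convolution kernel -/

theorem continuous : Continuous a := ha.differentiable.continuous

theorem even (x : ℝ) : a (-x) = a x := by
  have h := (ha.continuous.ae_eq_iff_eq volume (ha.continuous.comp continuous_neg)).1 ha.memU.2.1
  exact (congrFun h x).symm

theorem apply_abs (x : ℝ) : a |x| = a x := by
  rcases abs_choice x with h | h <;> rw [h]
  exact ha.even x

theorem strictAntiOn : StrictAntiOn a (Ici 0) :=
  strictAntiOn_of_deriv_neg (convex_Ici 0) ha.continuous.continuousOn fun x hx =>
    ha.deriv_neg x (by simpa using hx)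

theorem nonneg (x : ℝ) : 0 ≤ a x := by
  by_contra! h
  rw [← ha.apply_abs] at h
  have hev := ha.memU.2.2
  -- The sign condition holds only almost everywhere in the plane, but its violation is an open
  -- condition, so this null set is empty. The point `(1, |x| + 2)` would lie in it.
  set U : Set (ℝ × ℝ) := {p | 0 < p.1 ∧ p.1 < p.2 ∧ a p.2 < 0} with hU
  have hopen : IsOpen U := by
    refine (isOpen_lt continuous_const continuous_fst).inter
      ((isOpen_lt continuous_fst continuous_snd).inter
      (isOpen_lt (ha.continuous.comp continuous_snd) continuous_const))
  have h0 : (volume : Measure (ℝ × ℝ)) U = 0 :=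
    measure_mono_null (fun p hp => by
      intro hh
      exact hp.2.2.not_ge (hh hp.1 hp.2.1).2) (ae_iff.1 hev)
  have h1 : a (|x| + 2) < 0 := (ha.strictAntiOn.antitoneOn (abs_nonneg x)
    (show (0 : ℝ) ≤ |x| + 2 by positivity) (by linarith)).trans_lt h
  have h2 : ((1 : ℝ), |x| + 2) ∈ U := ⟨one_pos, by simp only; linarith [abs_nonneg x], h1⟩
  rw [(hopen.measure_eq_zero_iff (volume : Measure (ℝ × ℝ))).1 h0] at h2
  exact h2

theorem apply_le_zero (x : ℝ) : a x ≤ a 0 := by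
  rw [← ha.apply_abs]
  exact ha.strictAntiOn.antitoneOn self_mem_Ici (abs_nonneg x) (abs_nonneg x)

theorem deriv_odd (x : ℝ) : deriv a (-x) = -deriv a x := by
  have h : (fun y => a (-y)) = a := funext ha.even
  have h2 := deriv_comp_neg a x
  rw [h] at h2
  linarith

/-- On the half-line `a` is monotone and bounded below, so it has a limit, and a derivative of
constant sign is then integrable. Integrability of `a` forces the limit to be zero; oddness of the
derivative covers the other half-line. -/
theorem integrable_deriv : Integrable (deriv a) ∧ Tendsto a atTop (𝓝 0) := by
  have hanti : Antitone fun x => a (max x 0) := fun x y h =>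
    ha.strictAntiOn.antitoneOn (le_max_right x 0) (le_max_right y 0) (max_le_max_right 0 h)
  have hlim : Tendsto a atTop (𝓝 (⨅ x, a (max x 0))) := by
    refine (tendsto_atTop_ciInf hanti ⟨0, ?_⟩).congr' ?_
    · rintro _ ⟨x, rfl⟩
      exact ha.nonneg _
    · filter_upwards [eventually_ge_atTop 0] with x hx
      rw [max_eq_left hx]
  have h1 : IntegrableOn (deriv a) (Ioi 0) := integrableOn_Ioi_deriv_of_nonpos'
    (fun x _ => (ha.differentiable x).hasDerivAt) (fun x hx => (ha.deriv_neg x hx).le) hlim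
  have h2 : IntegrableOn (deriv a) (Iio 0) := by
    have h3 := IntegrableOn.comp_neg_Iio (c := (0 : ℝ)) (f := deriv a) (by simpa using h1)
    simp only [ha.deriv_odd] at h3
    simpa using h3.neg
  constructor
  · rw [← integrableOn_univ, ← Iic_union_Ioi (a := (0 : ℝ))]
    exact ((integrableOn_Iic_iff_integrableOn_Iio (by simp)).2 h2).union h1
  · exact tendsto_zero_of_hasDerivAt_of_integrableOn_Ioi (a := 0)
      (fun x _ => (ha.differentiable x).hasDerivAt) h1 ha.integrable.integrableOn

/-! ### The folded kernel -/

omit ha in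
/-- The kernel of convolution with `a` on odd functions, after multiplication by signs. -/
noncomputable def _root_.KreinRutman.foldKernel (a : ℝ → ℝ) (x y : ℝ) : ℝ :=
  (a (|x| - |y|) - a (|x| + |y|)) / 2

/-- Up to signs, `|x| ± |y|` are `x ± y` in some order, and `a` is even. In this form a row integral
is a mean of two translates of `a` minus a term that is small for large `|x|`. -/
theorem foldKernel_eq (x y : ℝ) :
    foldKernel a x y = (a (x - y) + a (x + y)) / 2 - a (|x| + |y|) := by
  have h : a (|x| - |y|) + a (|x| + |y|) = a (x - y) + a (x + y) := by
    rcases abs_choice x with h1 | h1 <;> rcases abs_choice y with h2 | h2 <;> rw [h1, h2]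
    · ring_nf
    · rw [← ha.even (-x - y), ← ha.even (-x + y)]
      ring_nf
    · rw [← ha.even (-x - -y), ← ha.even (-x + -y)]
      ring_nf
  rw [foldKernel]
  linarith

theorem abs_lt_abs {x y : ℝ} (h : |x| < |y|) : a y < a x := by
  rw [← ha.apply_abs x, ← ha.apply_abs y]
  exact ha.strictAntiOn (abs_nonneg x) (abs_nonneg y) h

theorem foldKernel_pos {x y : ℝ} (hx : x ≠ 0) (hy : y ≠ 0) : 0 < foldKernel a x y := by
  have h1 := abs_pos.2 hx
  have h2 := abs_pos.2 hy
  have h : |(|x| - |y|)| < |(|x| + |y|)| := by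
    rw [abs_of_pos (add_pos h1 h2), abs_lt]
    constructor <;> linarith
  have := ha.abs_lt_abs h
  rw [foldKernel]
  linarith

theorem isPosKernel : IsPosKernel (foldKernel a) where
  continuous := by
    have := ha.continuous
    unfold foldKernel Function.uncurry
    fun_prop
  symm x y := by
    rw [foldKernel, foldKernel, ← ha.even (|x| - |y|)]
    ring_nf
  nonneg x y := by
    by_cases hx : x = 0
    · simp [foldKernel, hx, ha.even]
    by_cases hy : y = 0
    · simp [foldKernel, hy]
    exact (ha.foldKernel_pos hx hy).le
  pos x y hx hy := ha.foldKernel_pos hx hy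
  bdd := ⟨a 0 / 2, fun x y => by
    have h1 := ha.apply_le_zero (|x| - |y|)
    have h2 := ha.nonneg (|x| + |y|)
    rw [foldKernel]
    linarith⟩

theorem foldKernel_le (x y : ℝ) : foldKernel a x y ≤ a 0 := by
  have h1 := ha.apply_le_zero (|x| - |y|)
  have h2 := ha.nonneg (|x| + |y|)
  have h3 := ha.nonneg 0
  rw [foldKernel]
  linarith

/-! ### Row integrals of the folded kernel -/

theorem integrable_sub (x : ℝ) : Integrable fun y => a (x - y) := ha.integrable.comp_sub_left x

theorem integrable_add (x : ℝ) : Integrable fun y => a (x + y) := ha.integrable.comp_add_left x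

theorem integrable_add_abs {x : ℝ} (hx : 0 ≤ x) : Integrable fun y => a (x + |y|) := by
  refine Integrable.mono' ha.integrable ?_ (Eventually.of_forall fun y => ?_)
  · have := ha.continuous
    exact Continuous.aestronglyMeasurable (by fun_prop)
  · rw [Real.norm_of_nonneg (ha.nonneg _), ← ha.apply_abs y]
    exact ha.strictAntiOn.antitoneOn (abs_nonneg y) (add_nonneg hx (abs_nonneg y)) (by linarith)

theorem integral_foldKernel_le_one (ξ x : ℝ) : ∫ y in Icc (-ξ) ξ, foldKernel a x y ≤ 1 := by
  have hi : Integrable fun y => (a (x - y) + a (x + y)) / 2 :=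
    ((ha.integrable_sub x).add (ha.integrable_add x)).div_const 2
  calc ∫ y in Icc (-ξ) ξ, foldKernel a x y ≤ ∫ y in Icc (-ξ) ξ, (a (x - y) + a (x + y)) / 2 := by
        refine integral_mono (ha.isPosKernel.continuous_right x).integrableOn_Icc
          hi.integrableOn fun y => ?_
        have h2 := ha.nonneg (|x| + |y|)
        simp only [ha.foldKernel_eq]
        linarith
    _ ≤ ∫ y, (a (x - y) + a (x + y)) / 2 := by
        refine setIntegral_le_integral hi (Eventually.of_forall fun y => ?_)
        have h1 := ha.nonneg (x - y)
        have h2 := ha.nonneg (x + y)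
        simp only [Pi.zero_apply]
        linarith
    _ = 1 := by
        rw [integral_div, integral_add (ha.integrable_sub x) (ha.integrable_add x),
          integral_sub_left_eq_self a volume x, integral_add_left_eq_self a x,
          ha.integral_eq_one]
        norm_num

theorem integral_foldKernel_le {ξ : ℝ} (hξ : 0 < ξ) (x : ℝ) :
    ∫ y in Icc (-ξ) ξ, foldKernel a x y ≤ 2 * ξ * a 0 := by
  calc ∫ y in Icc (-ξ) ξ, foldKernel a x y ≤ ∫ y in Icc (-ξ) ξ, a 0 :=
        integral_mono (ha.isPosKernel.continuous_right x).integrableOn_Icc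
          (continuous_const.integrableOn_Icc) fun y => ha.foldKernel_le x y
    _ = 2 * ξ * a 0 := by
        rw [setIntegral_const, Real.volume_real_Icc_of_le (by linarith), smul_eq_mul]
        ring

/-- Distance `ρ` from the endpoints puts `[-ρ, ρ]` inside both translated windows; distance `ρ` from
the origin controls the subtracted term. -/
theorem le_integral_foldKernel {ξ ρ x : ℝ} (hρ : 0 ≤ ρ) (h1 : ρ ≤ |x|) (h2 : |x| ≤ ξ - ρ) :
    (∫ y in -ρ..ρ, a y) - ∫ y, a (ρ + |y|) ≤ ∫ y in Icc (-ξ) ξ, foldKernel a x y := by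
  have hξ : -ξ ≤ ξ := by linarith [abs_nonneg x]
  obtain ⟨h3, h4⟩ := abs_le.1 h2
  have hmono : ∀ c d : ℝ, c ≤ -ρ → ρ ≤ d → ∫ y in -ρ..ρ, a y ≤ ∫ y in c..d, a y := by
    intro c d hc hd
    exact intervalIntegral.integral_mono_interval hc (by linarith) hd
      (Eventually.of_forall ha.nonneg) ha.integrable.intervalIntegrable
  have hs : ∫ y in -ρ..ρ, a y ≤ ∫ y in Icc (-ξ) ξ, a (x - y) := by
    rw [integral_Icc_eq_integral_Ioc, ← intervalIntegral.integral_of_le hξ,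
      intervalIntegral.integral_comp_sub_left]
    exact hmono _ _ (by linarith) (by linarith)
  have hp : ∫ y in -ρ..ρ, a y ≤ ∫ y in Icc (-ξ) ξ, a (x + y) := by
    rw [integral_Icc_eq_integral_Ioc, ← intervalIntegral.integral_of_le hξ,
      intervalIntegral.integral_comp_add_left]
    exact hmono _ _ (by linarith) (by linarith)
  have ht : ∫ y in Icc (-ξ) ξ, a (|x| + |y|) ≤ ∫ y, a (ρ + |y|) := by
    refine le_trans (integral_mono (ha.integrable_add_abs (abs_nonneg x)).integrableOn
      (ha.integrable_add_abs hρ).integrableOn fun y => ?_)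
      (setIntegral_le_integral (ha.integrable_add_abs hρ)
        (Eventually.of_forall fun y => ha.nonneg _))
    exact ha.strictAntiOn.antitoneOn (add_nonneg hρ (abs_nonneg y))
      (add_nonneg (abs_nonneg x) (abs_nonneg y)) (by linarith)
  simp only [ha.foldKernel_eq]
  rw [integral_sub, integral_div, integral_add]
  · linarith
  · exact (ha.integrable_sub x).integrableOn
  · exact (ha.integrable_add x).integrableOn
  · exact (((ha.integrable_sub x).add (ha.integrable_add x)).div_const 2).integrableOn
  · exact (ha.integrable_add_abs (abs_nonneg x)).integrableOn

theorem tendsto_integral_add_abs : Tendsto (fun ρ => ∫ y, a (ρ + |y|)) atTop (𝓝 0) := by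
  rw [← integral_zero ℝ ℝ (μ := volume)]
  refine tendsto_integral_filter_of_dominated_convergence a ?_ ?_ ha.integrable ?_
  · filter_upwards [eventually_ge_atTop 0] with ρ hρ
    exact (ha.integrable_add_abs hρ).aestronglyMeasurable
  · filter_upwards [eventually_ge_atTop 0] with ρ hρ
    refine Eventually.of_forall fun y => ?_
    rw [Real.norm_of_nonneg (ha.nonneg _), ← ha.apply_abs y]
    exact ha.strictAntiOn.antitoneOn (abs_nonneg y) (add_nonneg hρ (abs_nonneg y)) (by linarith)
  · refine Eventually.of_forall fun y => ?_
    exact ha.integrable_deriv.2.comp (tendsto_atTop_add_const_right _ _ tendsto_id)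

/-- For fixed large `ρ` every row with `ρ ≤ |x| ≤ ξ - ρ` has integral close to `1`, and the
proportion of such rows tends to `1` as `ξ` grows; the mean row integral is a lower bound for the
norm. -/
theorem exists_lt_norm_op {c : ℝ} (hc : c < 1) : ∃ ξ, 0 < ξ ∧ c < ‖ha.isPosKernel.op ξ‖ := by
  rcases lt_or_ge c 0 with hc0 | hc0
  · exact ⟨1, one_pos, hc0.trans_le (norm_nonneg _)⟩
  obtain ⟨d, hcd, hd⟩ := exists_between hc
  have hlim : Tendsto (fun ρ => (∫ y in -ρ..ρ, a y) - ∫ y, a (ρ + |y|)) atTop (𝓝 (1 - 0)) := by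
    refine Tendsto.sub ?_ ha.tendsto_integral_add_abs
    rw [← ha.integral_eq_one]
    exact intervalIntegral_tendsto_integral ha.integrable tendsto_neg_atTop_atBot tendsto_id
  rw [sub_zero] at hlim
  obtain ⟨ρ, hρd, hρ⟩ := ((hlim.eventually_const_lt hd).and (eventually_gt_atTop 0)).exists
  have hd0 : 0 < d := hc0.trans_lt hcd
  -- The good rows have total length `2 * ξ - 4 * ρ`, so `c * ξ < (ξ - 2 * ρ) * d` is needed. The
  -- first two summands give equality, the last makes it strict.
  set ξ := 2 * ρ + 2 * ρ * c / (d - c) + ρ with hξdef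
  have hdc : 0 < d - c := sub_pos.2 hcd
  have hξρ : 2 * ρ < ξ := by
    have : 0 ≤ 2 * ρ * c / (d - c) := by positivity
    rw [hξdef]
    linarith
  have hξ : 0 < ξ := by linarith
  refine ⟨ξ, hξ, ?_⟩
  have hK := ha.isPosKernel
  have hrow0 : ∀ x, 0 ≤ ∫ y in Icc (-ξ) ξ, foldKernel a x y := fun x =>
    integral_nonneg fun y => hK.nonneg x y
  have hind : ∀ r, Integrable ((Icc (-r) r).indicator fun _ : ℝ => d) := fun r =>
    (integrable_indicator_iff measurableSet_Icc).2
      (continuous_const (y := d)).integrableOn_Icc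
  have hrow : ∀ x, (Icc (-(ξ - ρ)) (ξ - ρ)).indicator (fun _ => d) x
      - (Icc (-ρ) ρ).indicator (fun _ => d) x ≤ ∫ y in Icc (-ξ) ξ, foldKernel a x y := by
    intro x
    by_cases h1 : x ∈ Icc (-ρ) ρ
    · rw [indicator_of_mem h1, indicator_of_mem (show x ∈ Icc (-(ξ - ρ)) (ξ - ρ) from
        ⟨by linarith [h1.1], by linarith [h1.2]⟩), sub_self]
      exact hrow0 x
    · rw [indicator_of_notMem h1, sub_zero]
      by_cases h2 : x ∈ Icc (-(ξ - ρ)) (ξ - ρ)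
      · rw [indicator_of_mem h2]
        refine hρd.le.trans (ha.le_integral_foldKernel hρ.le ?_ (abs_le.2 h2))
        by_contra! h3
        exact h1 (abs_le.1 h3.le)
      · rw [indicator_of_notMem h2]
        exact hrow0 x
  have hconst : ∀ r, 0 ≤ r → r ≤ ξ →
      ∫ x in Icc (-ξ) ξ, (Icc (-r) r).indicator (fun _ : ℝ => d) x = 2 * r * d := by
    intro r hr0 hr
    rw [setIntegral_indicator measurableSet_Icc,
      inter_eq_right.2 (Icc_subset_Icc (neg_le_neg hr) hr), setIntegral_const,
      Real.volume_real_Icc_of_le (by linarith), smul_eq_mul]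
    ring
  have hcont : Continuous fun x => ∫ y in Icc (-ξ) ξ, foldKernel a x y := by
    have := hK.continuous_kernelInt (fun _ => 1) ξ continuous_const.integrableOn_Icc
    unfold kernelInt at this
    simpa using this
  have h1 : 2 * (ξ - ρ) * d - 2 * ρ * d ≤ ‖hK.op ξ‖ * (2 * ξ) := by
    refine le_trans ?_ (hK.integral_integral_le hξ)
    rw [← hconst (ξ - ρ) (by linarith) (by linarith), ← hconst ρ hρ.le (by linarith),
      ← integral_sub (hind _).integrableOn (hind _).integrableOn]
    exact integral_mono ((hind _).sub (hind _)).integrableOn hcont.integrableOn_Icc hrow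
  have h2 : c * (2 * ξ) < 2 * (ξ - ρ) * d - 2 * ρ * d := by
    have h3 : ξ * (d - c) = 2 * ρ * (d - c) + 2 * ρ * c + ρ * (d - c) := by
      rw [hξdef]
      field_simp
    nlinarith [mul_pos hρ hdc]
  exact lt_of_mul_lt_mul_right (h2.trans_le h1) (by linarith)

/-! ### Differentiability of convolutions with cut-off functions -/

omit ha in
-- As `b` is merely integrable, the variable is moved onto the cut-off of `G`, which can be
-- discontinuous only at `±ξ`; for fixed `x₀` this concerns two values of `z`.
theorem continuous_integral_sub_mul {b G : ℝ → ℝ} (hb : Integrable b) (hG : Continuous G)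
    (ξ : ℝ) : Continuous fun x => ∫ y in Icc (-ξ) ξ, b (x - y) * G y := by
  have heq : (fun x => ∫ y in Icc (-ξ) ξ, b (x - y) * G y) =
      fun x => ∫ z, b z * (Icc (-ξ) ξ).indicator G (x - z) := by
    ext x
    rw [← integral_indicator measurableSet_Icc,
      ← integral_sub_left_eq_self (fun z => b z * (Icc (-ξ) ξ).indicator G (x - z)) volume x]
    refine integral_congr_ae (Eventually.of_forall fun y => ?_)
    by_cases h : y ∈ Icc (-ξ) ξ <;> simp [h]
  rw [heq, continuous_iff_continuousAt]
  intro x₀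
  obtain ⟨C, hC⟩ := (isCompact_Icc (a := -ξ) (b := ξ)).exists_bound_of_continuousOn hG.continuousOn
  have hmeas : Measurable ((Icc (-ξ) ξ).indicator G) := hG.measurable.indicator measurableSet_Icc
  refine continuousAt_of_dominated (bound := fun z => ‖b z‖ * |C|) ?_ ?_ (hb.norm.mul_const _) ?_
  · refine Eventually.of_forall fun x => ?_
    exact hb.aestronglyMeasurable.mul
      (hmeas.comp (measurable_const.sub measurable_id)).aestronglyMeasurable
  · refine Eventually.of_forall fun x => Eventually.of_forall fun z => ?_
    rw [norm_mul]
    gcongr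
    by_cases h : x - z ∈ Icc (-ξ) ξ
    · rw [indicator_of_mem h]
      exact (hC _ h).trans (le_abs_self C)
    · rw [indicator_of_notMem h, norm_zero]
      exact abs_nonneg C
  · filter_upwards [Measure.ae_ne volume (x₀ - ξ), Measure.ae_ne volume (x₀ + ξ)] with z h1 h2
    refine continuousAt_const.mul ?_
    have h3 : ContinuousAt ((Icc (-ξ) ξ).indicator G) (x₀ - z) := by
      by_cases h : x₀ - z ∈ Icc (-ξ) ξ
      · have hI : Icc (-ξ) ξ ∈ 𝓝 (x₀ - z) := Icc_mem_nhds
          (lt_of_le_of_ne h.1 fun hh => h2 (by linarith))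
          (lt_of_le_of_ne h.2 fun hh => h1 (by linarith))
        refine hG.continuousAt.congr ?_
        filter_upwards [hI] with t ht
        rw [indicator_of_mem ht]
      · refine (continuousAt_const (y := (0 : ℝ))).congr ?_
        filter_upwards [isClosed_Icc.isOpen_compl.mem_nhds h] with t ht
        rw [indicator_of_notMem ht]
    exact h3.comp (f := fun x => x - z) (continuousAt_id.sub continuousAt_const)

/-- The derivative of `a` is known to be integrable but need not be bounded or continuous, so the
candidate derivative is integrated instead: Fubini and the fundamental theorem for `a` recover the
convolution, and continuity of the candidate allows differentiating back. -/
theorem hasDerivAt_integral_sub_mul {G : ℝ → ℝ} (hG : Continuous G) (ξ x : ℝ) :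
    HasDerivAt (fun x => ∫ y in Icc (-ξ) ξ, a (x - y) * G y)
      (∫ y in Icc (-ξ) ξ, deriv a (x - y) * G y) x := by
  have hd := ha.integrable_deriv.1
  have hcont := continuous_integral_sub_mul hd hG ξ
  have hint : ∀ x, ∫ t in (0 : ℝ)..x, ∫ y in Icc (-ξ) ξ, deriv a (t - y) * G y =
      (∫ y in Icc (-ξ) ξ, a (x - y) * G y) - ∫ y in Icc (-ξ) ξ, a (0 - y) * G y := by
    intro x
    rw [intervalIntegral_integral_swap]
    · rw [← integral_sub]
      · refine integral_congr_ae (Eventually.of_forall fun y => ?_)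
        simp only
        rw [intervalIntegral.integral_mul_const, intervalIntegral.integral_comp_sub_right,
          intervalIntegral.integral_eq_sub_of_hasDerivAt
            (fun t _ => (ha.differentiable t).hasDerivAt) hd.intervalIntegrable]
        ring
      all_goals
        have := ha.continuous
        exact Continuous.integrableOn_Icc (by fun_prop)
    · have h1 := (Integrable.convolution_integrand (ContinuousLinearMap.mul ℝ ℝ)
        (hG.integrableOn_Icc (a := -ξ) (b := ξ) (μ := volume)) hd).mono_measure
        (Measure.prod_mono (Measure.restrict_le_self (s := uIoc 0 x)) le_rfl)
      refine h1.congr (Eventually.of_forall fun p => ?_)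
      simp [Function.uncurry, mul_comm]
  have h2 := (hcont.integral_hasStrictDerivAt 0 x).hasDerivAt
  have h3 : (fun x => ∫ y in Icc (-ξ) ξ, a (x - y) * G y) = fun x =>
      (∫ t in (0 : ℝ)..x, ∫ y in Icc (-ξ) ξ, deriv a (t - y) * G y) +
        ∫ y in Icc (-ξ) ξ, a (0 - y) * G y := by
    ext x
    rw [hint, sub_add_cancel]
  rw [h3]
  exact h2.add_const _

end IsKernel

/-! ### From positive kernels to odd functions -/

theorem ae_comp_neg {p : ℝ → Prop} (h : ∀ᵐ x : ℝ, p x) : ∀ᵐ x : ℝ, p (-x) :=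
  (Measure.measurePreserving_neg (volume : Measure ℝ)).quasiMeasurePreserving.ae h

/-- The negative sign function, with value `1` at the origin. -/
noncomputable def negSign (x : ℝ) : ℝ := if 0 < x then -1 else 1

theorem negSign_mul_self (x : ℝ) : negSign x * negSign x = 1 := by
  unfold negSign
  split_ifs <;> norm_num

theorem abs_negSign (x : ℝ) : |negSign x| = 1 := by
  unfold negSign
  split_ifs <;> norm_num

theorem negSign_of_pos {x : ℝ} (hx : 0 < x) : negSign x = -1 := if_pos hx

theorem negSign_of_neg {x : ℝ} (hx : x < 0) : negSign x = 1 := if_neg hx.not_gt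

theorem negSign_neg {x : ℝ} (hx : x ≠ 0) : negSign (-x) = -negSign x := by
  rcases lt_or_gt_of_ne hx with h | h
  · rw [negSign_of_neg h, negSign_of_pos (neg_pos.2 h)]
  · rw [negSign_of_pos h, negSign_of_neg (neg_neg_of_pos h), neg_neg]

theorem measurable_negSign : Measurable negSign :=
  Measurable.ite measurableSet_Ioi measurable_const measurable_const

theorem memLp_negSign_mul (u : L2) : MemLp (fun x => negSign x * u x) 2 :=
  (Lp.memLp u).of_le (measurable_negSign.aestronglyMeasurable.mul (Lp.aestronglyMeasurable u))
    (Eventually.of_forall fun x => by simp [abs_negSign])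

/-- Multiplication by `negSign` as an isometry of `L²`. -/
noncomputable def signFlip : L2 →ₗᵢ[ℝ] L2 where
  toFun u := (memLp_negSign_mul u).toLp
  map_add' u v := by
    rw [← MemLp.toLp_add]
    refine MemLp.toLp_congr _ _ ?_
    filter_upwards [Lp.coeFn_add u v] with x hx
    rw [hx, Pi.add_apply, Pi.add_apply, mul_add]
  map_smul' c u := by
    rw [RingHom.id_apply, ← MemLp.toLp_const_smul]
    refine MemLp.toLp_congr _ _ ?_
    filter_upwards [Lp.coeFn_smul c u] with x hx
    rw [hx, Pi.smul_apply, Pi.smul_apply, smul_eq_mul, smul_eq_mul]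
    ring
  norm_map' u := by
    have h : ∀ᵐ x : ℝ, ‖MemLp.toLp _ (memLp_negSign_mul u) x‖ = ‖u x‖ := by
      filter_upwards [(memLp_negSign_mul u).coeFn_toLp] with x hx
      rw [hx, norm_mul, Real.norm_eq_abs, abs_negSign, one_mul]
    exact le_antisymm (Lp.norm_le_norm_of_ae_le (h.mono fun _ => le_of_eq))
      (Lp.norm_le_norm_of_ae_le (h.mono fun _ => ge_of_eq))

theorem signFlip_coe (u : L2) : signFlip u =ᵐ[volume] fun x => negSign x * u x :=
  (memLp_negSign_mul u).coeFn_toLp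

theorem signFlip_signFlip (u : L2) : signFlip (signFlip u) = u := by
  refine Lp.ext ?_
  filter_upwards [signFlip_coe (signFlip u), signFlip_coe u] with x h1 h2
  rw [h1, h2, ← mul_assoc, negSign_mul_self, one_mul]

theorem setIntegral_comp_neg_Icc (f : ℝ → ℝ) (ξ : ℝ) :
    ∫ y in Icc (-ξ) ξ, f (-y) = ∫ y in Icc (-ξ) ξ, f y := by
  rw [← integral_indicator measurableSet_Icc, ← integral_indicator measurableSet_Icc,
    ← integral_neg_eq_self]
  refine integral_congr_ae (Eventually.of_forall fun y => ?_)
  have h : -y ∈ Icc (-ξ) ξ ↔ y ∈ Icc (-ξ) ξ := by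
    rw [mem_Icc, mem_Icc, neg_le_neg_iff, neg_le, and_comm]
  simp only
  by_cases hy : y ∈ Icc (-ξ) ξ
  · rw [indicator_of_mem hy, indicator_of_mem (h.2 hy), neg_neg]
  · rw [indicator_of_notMem hy, indicator_of_notMem (fun hh => hy (h.1 hh))]

theorem kernelInt_foldKernel_neg (a : ℝ → ℝ) (ξ : ℝ) (u : ℝ → ℝ) (x : ℝ) :
    kernelInt (foldKernel a) ξ u (-x) = kernelInt (foldKernel a) ξ u x := by
  simp only [kernelInt, foldKernel, abs_neg]

theorem opA_eq_integral (a : ℝ → ℝ) (ξ : ℝ) (v : ℝ → ℝ) (x : ℝ) :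
    opA a ξ v x = (Icc (-ξ) ξ).indicator (fun x => ∫ y in Icc (-ξ) ξ, a (x - y) * v y) x := by
  simp only [opA, cutoff]
  by_cases hx : x ∈ Icc (-ξ) ξ
  · rw [indicator_of_mem hx, indicator_of_mem hx, ← integral_indicator measurableSet_Icc,
      convolution]
    rw [← integral_sub_left_eq_self (fun t => (ContinuousLinearMap.mul ℝ ℝ) (a t)
      ((Icc (-ξ) ξ).indicator v (x - t))) volume x]
    refine integral_congr_ae (Eventually.of_forall fun y => ?_)
    by_cases hy : y ∈ Icc (-ξ) ξ <;> simp [hy]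
  · rw [indicator_of_notMem hx, indicator_of_notMem hx]

namespace IsKernel

variable {a : ℝ → ℝ} (ha : IsKernel a)

include ha

theorem integrableOn_sub_mul (v : L2) (ξ x : ℝ) :
    IntegrableOn (fun y => a (x - y) * v y) (Icc (-ξ) ξ) := by
  refine Integrable.bdd_mul (c := a 0) (L2.integrableOn_Icc v ξ) ?_ ?_
  · have := ha.continuous
    exact Continuous.aestronglyMeasurable (by fun_prop)
  · refine Eventually.of_forall fun y => ?_
    rw [Real.norm_of_nonneg (ha.nonneg _)]
    exact ha.apply_le_zero _

theorem continuous_integral_L2 (v : L2) (ξ : ℝ) :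
    Continuous fun x => ∫ y in Icc (-ξ) ξ, a (x - y) * v y := by
  refine continuous_of_dominated (bound := fun y => a 0 * |v y|) ?_ ?_ ?_ ?_
  · exact fun x => (ha.integrableOn_sub_mul v ξ x).aestronglyMeasurable
  · refine fun x => Eventually.of_forall fun y => ?_
    rw [norm_mul, Real.norm_of_nonneg (ha.nonneg _), Real.norm_eq_abs]
    gcongr
    exact ha.apply_le_zero _
  · exact (L2.integrableOn_Icc v ξ).abs.const_mul _
  · refine Eventually.of_forall fun y => ?_
    have := ha.continuous
    fun_prop

theorem negSign_mul_foldKernel {x y : ℝ} (hx : x ≠ 0) (hy : y ≠ 0) :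
    negSign x * foldKernel a x y * negSign y = (a (x - y) - a (x + y)) / 2 := by
  rcases lt_or_gt_of_ne hx with h1 | h1 <;> rcases lt_or_gt_of_ne hy with h2 | h2 <;>
    simp only [negSign_of_neg, negSign_of_pos, h1, h2, foldKernel, abs_of_neg, abs_of_pos]
  · rw [← ha.even (-x - -y), ← ha.even (-x + -y)]
    ring_nf
  · rw [← ha.even (-x - y), ← ha.even (-x + y)]
    ring_nf
  · ring_nf
  · ring_nf

/-- For odd `v` the substitution `y ↦ -y` shows that `a (x + y)` contributes the negative of `a (x -
y)`, so antisymmetrizing the kernel changes nothing. -/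
theorem integral_sub_mul_of_odd {v : L2} (hv : v ∈ L2odd) (ξ : ℝ) {x : ℝ} (hx : x ≠ 0) :
    ∫ y in Icc (-ξ) ξ, a (x - y) * v y =
      negSign x * kernelInt (foldKernel a) ξ (signFlip v) x := by
  have hi := ha.integrableOn_sub_mul v ξ
  have hneg : ∫ y in Icc (-ξ) ξ, a (x + y) * v y = -∫ y in Icc (-ξ) ξ, a (x - y) * v y := by
    rw [← setIntegral_comp_neg_Icc, ← integral_neg]
    refine integral_congr_ae (ae_restrict_of_ae ?_)
    filter_upwards [hv] with y hy
    rw [hy, ← sub_eq_add_neg]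
    ring
  have hi2 : IntegrableOn (fun y => a (x + y) * v y) (Icc (-ξ) ξ) := by
    refine Integrable.bdd_mul (c := a 0) (L2.integrableOn_Icc v ξ) ?_ ?_
    · have := ha.continuous
      exact Continuous.aestronglyMeasurable (by fun_prop)
    · refine Eventually.of_forall fun y => ?_
      rw [Real.norm_of_nonneg (ha.nonneg _)]
      exact ha.apply_le_zero _
  have h : negSign x * kernelInt (foldKernel a) ξ (signFlip v) x =
      ∫ y in Icc (-ξ) ξ, (a (x - y) * v y - a (x + y) * v y) / 2 := by
    rw [kernelInt, ← integral_const_mul]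
    refine integral_congr_ae (ae_restrict_of_ae ?_)
    filter_upwards [signFlip_coe v, Measure.ae_ne volume (0 : ℝ)] with y h1 h2
    have := ha.negSign_mul_foldKernel hx h2
    rw [h1, ← mul_assoc, ← mul_assoc, this]
    ring
  rw [h, integral_div, integral_sub (hi x) hi2, hneg]
  ring

theorem opA_eq {v : L2} (hv : v ∈ L2odd) (ξ : ℝ) {x : ℝ} (hx : x ≠ 0) :
    opA a ξ v x =
      negSign x * (Icc (-ξ) ξ).indicator (kernelInt (foldKernel a) ξ (signFlip v)) x := by
  rw [opA_eq_integral]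
  by_cases h : x ∈ Icc (-ξ) ξ
  · rw [indicator_of_mem h, indicator_of_mem h, ha.integral_sub_mul_of_odd hv ξ hx]
  · rw [indicator_of_notMem h, indicator_of_notMem h, mul_zero]

theorem isEigenfunction_iff {ξ μ : ℝ} {v : L2} : IsEigenfunction a ξ μ v ↔
    v ∈ L2odd ∧ v ≠ 0 ∧ ha.isPosKernel.op ξ (signFlip v) = μ • signFlip v := by
  refine and_congr_right fun hv => and_congr_right fun _ => ?_
  have hop := ha.isPosKernel.op_coe ξ (signFlip v)
  constructor
  · intro h
    refine Lp.ext ?_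
    filter_upwards [h, hop, Lp.coeFn_smul μ (signFlip v), signFlip_coe v,
      Measure.ae_ne volume (0 : ℝ)] with x h1 h2 h3 h4 h5
    rw [ha.opA_eq hv ξ h5] at h1
    rw [h2, h3, Pi.smul_apply, h4, smul_eq_mul, mul_left_comm, ← h1, ← mul_assoc,
      negSign_mul_self, one_mul]
  · intro h
    rw [h] at hop
    filter_upwards [hop, Lp.coeFn_smul μ (signFlip v), signFlip_coe v,
      Measure.ae_ne volume (0 : ℝ)] with x h1 h2 h3 h4
    rw [ha.opA_eq hv ξ h4, ← h1, h2, Pi.smul_apply, h3, smul_eq_mul, mul_left_comm,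
      ← mul_assoc (negSign x), negSign_mul_self, one_mul]

/-! ### The odd eigenfunction and its regularity -/

section

variable {ξ : ℝ} (hξ : 0 < ξ)

include hξ

/-- The folded kernel depends on `x` only through `|x|`, so the Perron function is even, and the
sign flip makes it odd. -/
theorem signFlip_perron_mem_coneN : signFlip (ha.isPosKernel.perron ξ) ∈ coneN := by
  obtain ⟨hu0, -, hu⟩ := ha.isPosKernel.perron_spec hξ
  have hcoe := ha.isPosKernel.eigen_coe (ha.isPosKernel.norm_op_pos hξ).ne' hu
  set u := ha.isPosKernel.perron ξ
  constructor
  · filter_upwards [signFlip_coe u, ae_comp_neg (signFlip_coe u), hcoe, ae_comp_neg hcoe,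
      Measure.ae_ne volume (0 : ℝ)] with x h1 h2 h3 h4 h5
    have hmem : -x ∈ Icc (-ξ) ξ ↔ x ∈ Icc (-ξ) ξ := by
      rw [mem_Icc, mem_Icc, neg_le_neg_iff, neg_le, and_comm]
    have heven : u (-x) = u x := by
      rw [h3, h4]
      by_cases h : x ∈ Icc (-ξ) ξ
      · rw [indicator_of_mem h, indicator_of_mem (hmem.2 h), kernelInt_foldKernel_neg]
      · rw [indicator_of_notMem h, indicator_of_notMem (fun hh => h (hmem.1 hh))]
    rw [h1, h2, heven, negSign_neg h5]
    ring
  · filter_upwards [signFlip_coe u, (Lp.coeFn_nonneg u).2 hu0] with x h1 h2 h3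
    rw [h1, negSign_of_pos h3, neg_one_mul, neg_nonpos]
    exact h2

theorem isEigenfunction_signFlip_perron :
    IsEigenfunction a ξ ‖ha.isPosKernel.op ξ‖ (signFlip (ha.isPosKernel.perron ξ)) := by
  rw [ha.isEigenfunction_iff, signFlip_signFlip]
  refine ⟨(ha.signFlip_perron_mem_coneN hξ).1, fun h => ?_, (ha.isPosKernel.perron_spec hξ).2.2⟩
  exact ha.isPosKernel.perron_ne_zero hξ ((map_eq_zero_iff _ signFlip.injective).1 h)

/-- No eigenvalue exceeds the operator norm, and the flipped Perron function attains it. -/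
theorem isGreatest_eigenvalues : IsGreatest (eigenvalues a ξ) ‖ha.isPosKernel.op ξ‖ := by
  refine ⟨⟨_, ha.isEigenfunction_signFlip_perron hξ⟩, ?_⟩
  rintro μ ⟨v, hv⟩
  obtain ⟨-, hne, h⟩ := ha.isEigenfunction_iff.1 hv
  have h1 := (ha.isPosKernel.op ξ).le_opNorm (signFlip v)
  rw [h, norm_smul, LinearIsometry.norm_map] at h1
  exact (le_abs_self μ).trans (le_of_mul_le_mul_right h1 (norm_pos_iff.2 hne))

theorem krEigenvalue_eq : krEigenvalue a ξ = ‖ha.isPosKernel.op ξ‖ :=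
  (ha.isGreatest_eigenvalues hξ).csSup_eq

/-- Bootstrapping: the eigenvalue equation first gives a continuous representative `G`, and
inserting `G` into the equation again makes it `C¹`. The slope at the origin is a positive multiple
of the integral of `deriv a (-y) * G y`, which is negative for `y ≠ 0` since the factors are odd
with opposite signs. -/
theorem signFlip_perron_mem_coneNtilde :
    signFlip (ha.isPosKernel.perron ξ) ∈ coneNtilde ξ := by
  have hK := ha.isPosKernel
  obtain ⟨hu0, -, hu⟩ := hK.perron_spec hξ
  have hΛ := hK.norm_op_pos hξ
  have hcoe := hK.eigen_coe hΛ.ne' hu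
  have hN := ha.signFlip_perron_mem_coneN hξ
  have hpos : ∀ x, x ≠ 0 → 0 < kernelInt (foldKernel a) ξ (hK.perron ξ) x := fun x hx =>
    hK.kernelInt_pos_of_eigen hΛ.ne' hu0 (hK.perron_ne_zero hξ) hu hx
  set u := hK.perron ξ
  set Λ := ‖hK.op ξ‖
  set v := signFlip u with hv
  have hΛi : 0 < Λ⁻¹ := inv_pos.2 hΛ
  set G : ℝ → ℝ := fun x => Λ⁻¹ * ∫ y in Icc (-ξ) ξ, a (x - y) * v y with hG
  have hGc : Continuous G := (ha.continuous_integral_L2 v ξ).const_mul _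
  have hGs : ∀ x, x ≠ 0 → G x = negSign x * (Λ⁻¹ * kernelInt (foldKernel a) ξ u x) := by
    intro x hx
    simp only [hG]
    rw [ha.integral_sub_mul_of_odd hN.1 ξ hx, hv, signFlip_signFlip]
    ring
  have hvG : v =ᵐ[volume] (Icc (-ξ) ξ).indicator G := by
    filter_upwards [signFlip_coe u, hcoe, Measure.ae_ne volume (0 : ℝ)] with x h1 h2 h3
    rw [h1, h2]
    by_cases h : x ∈ Icc (-ξ) ξ
    · rw [indicator_of_mem h, indicator_of_mem h, hGs x h3]
    · rw [indicator_of_notMem h, indicator_of_notMem h, mul_zero]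
  have hGfix : G = fun x => Λ⁻¹ * ∫ y in Icc (-ξ) ξ, a (x - y) * G y := by
    ext x
    simp only [hG]
    congr 1
    refine integral_congr_ae ?_
    rw [EventuallyEq, ae_restrict_iff' measurableSet_Icc]
    filter_upwards [hvG] with y h1 h2
    rw [h1, indicator_of_mem h2]
  have hderiv : ∀ x, HasDerivAt G (Λ⁻¹ * ∫ y in Icc (-ξ) ξ, deriv a (x - y) * G y) x := by
    intro x
    have h := (ha.hasDerivAt_integral_sub_mul hGc ξ x).const_mul Λ⁻¹
    rwa [← hGfix] at h
  have hGC1 : ContDiff ℝ 1 G := by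
    rw [contDiff_one_iff_deriv]
    refine ⟨fun x => (hderiv x).differentiableAt, ?_⟩
    rw [show deriv G = _ from funext fun x => (hderiv x).deriv]
    exact (continuous_integral_sub_mul ha.integrable_deriv.1 hGc ξ).const_mul _
  have hGneg : ∀ x, 0 < x → G x < 0 := by
    intro x hx
    rw [hGs x hx.ne', negSign_of_pos hx, neg_one_mul, neg_lt_zero]
    exact mul_pos hΛi (hpos x hx.ne')
  have hGpos : ∀ x, x < 0 → 0 < G x := by
    intro x hx
    rw [hGs x hx.ne, negSign_of_neg hx, one_mul]
    exact mul_pos hΛi (hpos x hx.ne)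
  have hint : IntegrableOn (fun y => deriv a (0 - y) * G y) (Icc (-ξ) ξ) :=
    (ha.integrable_deriv.1.comp_sub_left 0).integrableOn.mul_continuousOn hGc.continuousOn
      isCompact_Icc
  have hneg : ∀ y, y ≠ 0 → deriv a (0 - y) * G y < 0 := by
    intro y hy
    rw [zero_sub]
    rcases lt_or_gt_of_ne hy with h | h
    · exact mul_neg_of_neg_of_pos (ha.deriv_neg _ (neg_pos.2 h)) (hGpos y h)
    · rw [ha.deriv_odd]
      exact mul_neg_of_pos_of_neg (neg_pos.2 (ha.deriv_neg y h)) (hGneg y h)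
  have hD : ∫ y in Icc (-ξ) ξ, deriv a (0 - y) * G y < 0 := by
    have hn : 0 ≤ᵐ[volume.restrict (Icc (-ξ) ξ)] -fun y => deriv a (0 - y) * G y := by
      refine ae_restrict_of_ae ?_
      filter_upwards [Measure.ae_ne volume (0 : ℝ)] with y hy
      simpa using (hneg y hy).le
    have hI := integral_nonneg_of_ae hn
    rw [integral_neg'] at hI
    refine lt_of_le_of_ne (neg_nonneg.1 hI) fun h0 => ?_
    have h1 : ∫ y in Icc (-ξ) ξ, (-fun y => deriv a (0 - y) * G y) y = 0 := by
      rw [integral_neg', h0, neg_zero]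
    rw [integral_eq_zero_iff_of_nonneg_ae hn hint.neg, EventuallyEq,
      ae_restrict_iff' measurableSet_Icc] at h1
    obtain ⟨y, hy, h2, h3⟩ := exists_mem_Icc_of_ae hξ (h1.and (Measure.ae_ne volume (0 : ℝ)))
    exact (hneg y h3).ne (by simpa using h2 hy)
  -- `G` itself is negative on all of `(0, ∞)`, so the representative is its cut-off; near the
  -- origin the two agree.
  refine ⟨hN, (Icc (-ξ) ξ).indicator G, hvG, ?_, ?_, ?_, ?_⟩
  · exact hGC1.contDiffOn.congr fun x hx => indicator_of_mem hx G
  · have heq : (Icc (-ξ) ξ).indicator G =ᶠ[𝓝 0] G := by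
      filter_upwards [Icc_mem_nhds (neg_lt_zero.2 hξ) hξ] with x hx
      exact indicator_of_mem hx G
    rw [heq.deriv_eq, (hderiv 0).deriv]
    exact mul_neg_of_pos_of_neg hΛi hD
  · intro x hx hxξ
    rw [indicator_of_mem (show x ∈ Icc (-ξ) ξ from ⟨by linarith, hxξ⟩)]
    exact hGneg x hx
  · intro x hx
    exact indicator_of_notMem (fun hh => hx.not_ge hh.2) G

theorem isKREigenfunction_signFlip_perron :
    IsKREigenfunction a ξ (signFlip (ha.isPosKernel.perron ξ)) := by
  refine ⟨?_, ha.signFlip_perron_mem_coneNtilde hξ, ?_⟩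
  · rw [ha.krEigenvalue_eq hξ]
    exact ha.isEigenfunction_signFlip_perron hξ
  · rw [LinearIsometry.norm_map, (ha.isPosKernel.perron_spec hξ).2.1]

omit ha hξ in
theorem _root_.KreinRutman.signFlip_nonneg {w : L2} (hw : w ∈ coneN) : 0 ≤ signFlip w := by
  rw [← Lp.coeFn_nonneg]
  filter_upwards [signFlip_coe w, hw.1, hw.2, ae_comp_neg hw.2, Measure.ae_ne volume (0 : ℝ)]
    with x h1 h2 h3 h4 h5
  rw [h1]
  rcases lt_or_gt_of_ne h5 with h | h
  · rw [negSign_of_neg h, one_mul, h2]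
    exact neg_nonneg.2 (h4 (neg_pos.2 h))
  · rw [negSign_of_pos h, neg_one_mul]
    exact neg_nonneg.2 (h3 h)

theorem eq_signFlip_perron {w : L2} (hw : IsKREigenfunction a ξ w) :
    w = signFlip (ha.isPosKernel.perron ξ) := by
  obtain ⟨h1, h2, h3⟩ := hw
  rw [ha.krEigenvalue_eq hξ, ha.isEigenfunction_iff] at h1
  rw [← ha.isPosKernel.eq_perron hξ (signFlip_nonneg h2.1) (by rw [LinearIsometry.norm_map, h3])
    h1.2.2, signFlip_signFlip]

theorem krEigenfunction_eq : krEigenfunction a ξ = signFlip (ha.isPosKernel.perron ξ) :=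
  ha.eq_signFlip_perron hξ (Classical.epsilon_spec
    (p := IsKREigenfunction a ξ) ⟨_, ha.isKREigenfunction_signFlip_perron hξ⟩)

theorem eq_smul_krEigenfunction {w : L2} (hw : IsEigenfunction a ξ (krEigenvalue a ξ) w) :
    ∃ c : ℝ, w = c • krEigenfunction a ξ := by
  rw [ha.krEigenvalue_eq hξ, ha.isEigenfunction_iff] at hw
  refine ⟨inner ℝ (signFlip w) (ha.isPosKernel.perron ξ), ?_⟩
  rw [ha.krEigenfunction_eq hξ, ← map_smul, ← ha.isPosKernel.eigen_eq_smul_perron hξ hw.2.2,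
    signFlip_signFlip]

end

/-! ### Continuity, monotonicity and limits in the original setting -/

theorem continuousOn_krEigenvalue : ContinuousOn (fun ξ => krEigenvalue a ξ) (Ioi 0) :=
  (continuous_fst.comp_continuousOn ha.isPosKernel.continuousOn_norm_op_perron).congr
    fun _ hξ => ha.krEigenvalue_eq hξ

theorem continuousOn_krEigenfunction : ContinuousOn (fun ξ => krEigenfunction a ξ) (Ioi 0) :=
  ((signFlip.continuous.comp continuous_snd).comp_continuousOn
    ha.isPosKernel.continuousOn_norm_op_perron).congr fun _ hξ => ha.krEigenfunction_eq hξ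

theorem strictMonoOn_krEigenvalue : StrictMonoOn (fun ξ => krEigenvalue a ξ) (Ioi 0) := by
  intro η hη ξ hξ h
  simp only
  rw [ha.krEigenvalue_eq hη, ha.krEigenvalue_eq hξ]
  exact ha.isPosKernel.norm_op_lt hη h

theorem tendsto_krEigenvalue_zero : Tendsto (fun ξ => krEigenvalue a ξ) (𝓝[>] 0) (𝓝 0) := by
  have hlim : Tendsto (fun ξ => 2 * ξ * a 0) (𝓝[>] 0) (𝓝 0) := by
    refine Tendsto.mono_left ?_ nhdsWithin_le_nhds
    exact Continuous.tendsto' (by fun_prop) _ _ (by simp)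
  refine tendsto_of_tendsto_of_tendsto_of_le_of_le' tendsto_const_nhds hlim ?_ ?_ <;>
    filter_upwards [self_mem_nhdsWithin] with ξ hξ <;> rw [ha.krEigenvalue_eq hξ]
  · exact norm_nonneg _
  · exact ha.isPosKernel.norm_op_le hξ fun x _ => ha.integral_foldKernel_le hξ x

theorem tendsto_krEigenvalue_one : Tendsto (fun ξ => krEigenvalue a ξ) atTop (𝓝 1) := by
  refine tendsto_order.2 ⟨fun c hc => ?_, fun c hc => ?_⟩
  -- A single radius beyond `c` suffices by monotonicity.
  · obtain ⟨η, hη, hcη⟩ := ha.exists_lt_norm_op hc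
    filter_upwards [eventually_gt_atTop η] with ξ hξ
    rw [ha.krEigenvalue_eq (hη.trans hξ)]
    exact hcη.trans (ha.isPosKernel.norm_op_lt hη hξ)
  · filter_upwards [eventually_gt_atTop 0] with ξ hξ
    rw [ha.krEigenvalue_eq hξ]
    exact (ha.isPosKernel.norm_op_le hξ fun x _ => ha.integral_foldKernel_le_one ξ x).trans_lt hc

end IsKernel

end KreinRutman

theorem proposition2p3 (a : ℝ → ℝ) (ha : KreinRutman.IsKernel a) :
    -- `λ_ξ` and `v_ξ` are well defined, and `λ_ξ` is a simple eigenvalue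
    (∀ ξ : ℝ, 0 < ξ →
      IsGreatest (KreinRutman.eigenvalues a ξ) (KreinRutman.krEigenvalue a ξ) ∧
      KreinRutman.IsKREigenfunction a ξ (KreinRutman.krEigenfunction a ξ) ∧
      (∀ w, KreinRutman.IsKREigenfunction a ξ w → w = KreinRutman.krEigenfunction a ξ) ∧
      (∀ w, KreinRutman.IsEigenfunction a ξ (KreinRutman.krEigenvalue a ξ) w →
        ∃ c : ℝ, w = c • KreinRutman.krEigenfunction a ξ)) ∧
    -- dependence on `ξ`
    ContinuousOn (fun ξ : ℝ => KreinRutman.krEigenvalue a ξ) (Set.Ioi 0) ∧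
    StrictMonoOn (fun ξ : ℝ => KreinRutman.krEigenvalue a ξ) (Set.Ioi 0) ∧
    Tendsto (fun ξ : ℝ => KreinRutman.krEigenvalue a ξ) (𝓝[>] 0) (𝓝 0) ∧
    Tendsto (fun ξ : ℝ => KreinRutman.krEigenvalue a ξ) atTop (𝓝 1) ∧
    ContinuousOn (fun ξ : ℝ => KreinRutman.krEigenfunction a ξ) (Set.Ioi 0) :=
  ⟨fun ξ hξ => ⟨by
      rw [ha.krEigenvalue_eq hξ]
      exact ha.isGreatest_eigenvalues hξ, by
      rw [ha.krEigenfunction_eq hξ]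
      exact ha.isKREigenfunction_signFlip_perron hξ, fun w hw => by
      rw [ha.krEigenfunction_eq hξ]
      exact ha.eq_signFlip_perron hξ hw, fun w hw => ha.eq_smul_krEigenfunction hξ hw⟩,
    ha.continuousOn_krEigenvalue, ha.strictMonoOn_krEigenvalue, ha.tendsto_krEigenvalue_zero,
    ha.tendsto_krEigenvalue_one, ha.continuousOn_krEigenfunction⟩
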